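/- Let $\lambda<0$, $\beta>0$, $\gamma>0$ be real with $\gamma-\lambda-\beta>-1$, let $n\ge 0$ be an integer, and for $t\ge 0$ let $$w(x;t)=(x+t)^{-(\lambda+\beta)}x^{\gamma}e^{-x-t},\qquad x\in(0,\infty).$$ Let $P_j(x)=P_j(x;t)$ be the monic polynomials orthogonal with respect to $w(\cdot;t)$ on $(0,\infty)$, $h_j(t)=\int_0^\infty P_j(x)^2w(x;t)\,dx$, let $\widehat D_n(t)=\det\bigl(\int_0^\infty x^{j+k}w(x;t)\,dx\bigr)_{0\le j,k\le n-1}$ be the Hankel determinant, and put $$\widehat R_j(t)=\frac{\gamma}{h_j(t)}\int_0^\infty\frac{P_j(x)^2}{x}\,w(x;t)\,dx,\qquad \widehat H_n(t)=t\frac{d}{dt}\ln\frac{\widehat D_n(t)}{\widehat D_n(0)} .$$ (a) Suppose $\beta+\lambda\neq 0$ and define $\widehat y$ by $\widehat R_n(t)=1+\dfrac{1}{\widehat y(t)-1}$. Then for $t>0$ the function $\widehat y$ is well defined, twice continuously differentiable, takes neither of the values $0,1$, and satisfies $$\widehat y''=\frac{(3\widehat y-1)(\widehat y')^2}{2\widehat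 y(\widehat y-1)}-\frac{\widehat y'}{t}+\frac{(\widehat y-1)^2}{2t^2}\Bigl((\beta+\lambda)^2\widehat y-\frac{\gamma^2}{\widehat y}\Bigr)-\frac{(2n+1+\gamma-\beta-\lambda)\widehat y}{t}-\frac{\widehat y(\widehat y+1)}{2(\widehat y-1)} .$$ It has the initial data $$\widehat y(0)=\frac{\gamma}{\beta+\lambda}\quad\text{if }\gamma-\lambda-\beta>0,\qquad \widehat y'(0)=\frac{\gamma(2n+1+\gamma-\beta-\lambda)}{(\beta+\lambda)\bigl((\beta+\lambda-\gamma)^2-1\bigr)}\quad\text{if }\gamma-\lambda-\beta>1,$$ where $\widehat y$ is continuous from the right at $0$ in the first case and $\widehat y'(0)$ is the right derivative in the second. (b) For $t\ge0$ one has $\widehat D_n(t)>0$. For $t>0$ one has $\widehat H_n(t)=-t\sum_{j=0}^{n-1}\widehat R_j(t)$; the function $\widehat H_n$ is twice continuously differentiable there and satisfies $$(t\widehat H_n'')^2=4(n+\widehat H_n')(\widehat H_n-t\widehat H_n')(\widehat H_n'-\gamma)+\bigl((t-\gamma+\beta+\lambda)\widehat H_n'-\widehat H_n-n\gamma\bigr)^2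 .$$ Equivalently, $\sigma(t)=\widehat H_n(t)+nt+n(\beta+\lambda)$ satisfies the Jimbo–Miwa–Okamoto $\sigma$-form of Painlevé V, $$(t\sigma'')^2=\bigl(\sigma-t\sigma'+2(\sigma')^2+(v_0+v_1+v_2+v_3)\sigma'\bigr)^2-4(v_0+\sigma')(v_1+\sigma')(v_2+\sigma')(v_3+\sigma'),$$ with $v_0=0$, $v_1=-n$, $v_2=-\beta-\lambda$, $v_3=-n-\gamma$. Moreover $\widehat H_n(0)=0$, with $\widehat H_n$ continuous from the right at $0$, and if $\gamma-\lambda-\beta>0$ then the right derivative at $0$ is $$\widehat H_n'(0)=\frac{n\gamma}{\beta+\lambda-\gamma}.$$ (c) If $\beta+\lambda\ne0$, then for $t>0$ $$\widehat H_n=\frac{(t\widehat y')^2}{4\widehat y(\widehat y-1)^2}-\frac{\bigl((\beta+\lambda)\widehat y-\gamma\bigr)^2}{4\widehat y}+\frac{t(\beta+\lambda-2n)\widehat y}{2(\widehat y-1)}-\frac{\gamma t}{2(\widehat y-1)}-\frac{t^2\widehat y}{4(\widehat y-1)^2}.$$ -/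

import Mathlib

open Set Filter Topology MeasureTheory

noncomputable section

namespace PerturbedLaguerre

/-- The weight `w(x;t) = (x+t)^{-(λ+β)} x^γ e^{-x-t}` on `(0,∞)`. -/
def weight (lam bet gam t x : ℝ) : ℝ :=
  (x + t) ^ (-(lam + bet)) * x ^ gam * Real.exp (-x - t)

/-- The `n × n` Hankel determinant `det (∫₀^∞ x^{j+k} w(x;t) dx)_{0 ≤ j,k ≤ n-1}`. -/
def hankelDet (lam bet gam : ℝ) (n : ℕ) (t : ℝ) : ℝ :=
  (Matrix.of fun j k : Fin n =>
    ∫ x in Ioi (0 : ℝ), x ^ ((j : ℕ) + (k : ℕ)) * weight lam bet gam t x).det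

/-- The monic orthogonal polynomials `P_n(x;t)` of the weight on `(0,∞)`: the (unnormalized)
Gram–Schmidt process in `L²(w dx)`, applied to the monomials `1, x, x², …`. -/
def monicOP (lam bet gam t : ℝ) (n : ℕ) : Polynomial ℝ :=
  Polynomial.X ^ n - ∑ j : Fin n,
    Polynomial.C
      ((∫ x in Ioi (0 : ℝ), x ^ n * (monicOP lam bet gam t j).eval x * weight lam bet gam t x) /
        (∫ x in Ioi (0 : ℝ), (monicOP lam bet gam t j).eval x ^ 2 * weight lam bet gam t x)) *
      monicOP lam bet gam t j
termination_by n
decreasing_by all_goals exact j.isLt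

/-- `h_n(t) = ∫₀^∞ P_n(x;t)² w(x;t) dx`. -/
def normSq (lam bet gam : ℝ) (n : ℕ) (t : ℝ) : ℝ :=
  ∫ x in Ioi (0 : ℝ), (monicOP lam bet gam t n).eval x ^ 2 * weight lam bet gam t x

/-- `R̂_n(t) = (γ / h_n) ∫₀^∞ P_n(x)² w(x;t) / x dx`. -/
def Rhat (lam bet gam : ℝ) (n : ℕ) (t : ℝ) : ℝ :=
  gam / normSq lam bet gam n t *
    ∫ x in Ioi (0 : ℝ), (monicOP lam bet gam t n).eval x ^ 2 / x * weight lam bet gam t x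

/-- `ŷ`, determined by `R̂_n = 1 + 1 / (ŷ - 1)`. -/
def yhat (lam bet gam : ℝ) (n : ℕ) (t : ℝ) : ℝ :=
  1 + 1 / (Rhat lam bet gam n t - 1)

/-- `Ĥ_n(t) = t (d/dt) ln (D̂_n(t) / D̂_n(0))`. -/
def Hhat (lam bet gam : ℝ) (n : ℕ) (t : ℝ) : ℝ :=
  t * deriv (fun s => Real.log (hankelDet lam bet gam n s / hankelDet lam bet gam n 0)) t

/-- The Jimbo–Miwa–Okamoto `σ`-form of Painlevé V with parameters `v₀, v₁, v₂, v₃`, for a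
function `σ` on `(0,∞)`. -/
def SatisfiesSigmaPV (v₀ v₁ v₂ v₃ : ℝ) (σ : ℝ → ℝ) : Prop :=
  ContDiffOn ℝ 2 σ (Ioi 0) ∧
  ∀ t : ℝ, 0 < t →
    (t * deriv (deriv σ) t) ^ 2 =
      (σ t - t * deriv σ t + 2 * deriv σ t ^ 2 + (v₀ + v₁ + v₂ + v₃) * deriv σ t) ^ 2 -
        4 * (v₀ + deriv σ t) * (v₁ + deriv σ t) * (v₂ + deriv σ t) * (v₃ + deriv σ t)

end PerturbedLaguerre

end

/-!
Write `L`, `N`, `S` for integration against `w`, `w / x` and `w / (x + t)`. Integration by parts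
gives `L q' = (λ + β) S q - γ N q + L q`. Applied to `P_n ^ 2`, `P_n P_{n-1}`, `x P_n ^ 2` and
`x P_n P_{n-1}`, this expresses the recurrence coefficients through
`R_n = γ N (P_n ^ 2) / h_n` and `r_n = γ N (P_n P_{n-1}) / h_{n-1}`. The values `P_n (0)` and
`P_n (-t)` enter `N` and `S` only through rank-one quadratic forms, which yields two further
quadratic relations. Differentiating in `t` one finds `h_n' = -R_n h_n` and `p_n' = r_n + n` for the
next-to-leading coefficient `p_n`, hence a closed first-order system for `(R_n, r_n)`. Eliminating
`r_n` gives Painlevé V for `ŷ`, and eliminating `R_n` gives the `σ`-form. At `t = 0` the weight is a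
classical Laguerre weight with explicit coefficients, and `R_n'(0)` comes from linearising the
system at its singular point `t = 0`.
-/

noncomputable section

namespace PerturbedLaguerre

open Polynomial

theorem hasDerivWithinAt_Ici_of_tendsto {E : Type*} [NormedAddCommGroup E] [NormedSpace ℝ E]
    {f g : ℝ → E} {x₀ : ℝ} {e : E} (hf : ContinuousWithinAt f (Ici x₀) x₀)
    (hg : Tendsto g (𝓝[>] x₀) (𝓝 e)) (h : ∀ x, x₀ < x → HasDerivAt f (g x) x) :
    HasDerivWithinAt f e (Ici x₀) x₀ := by
  refine hasDerivWithinAt_Ici_of_tendsto_deriv (s := Ioi x₀)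
    (fun x hx => (h x hx).differentiableAt.differentiableWithinAt)
    (hf.mono Ioi_subset_Ici_self) self_mem_nhdsWithin (hg.congr' ?_)
  filter_upwards [self_mem_nhdsWithin] with x hx using (h x hx).deriv.symm

theorem hasDerivWithinAt_Ici_of_hasDerivAt_div {f F : ℝ → ℝ} {F' : ℝ}
    (hf : ContinuousWithinAt f (Ici 0) 0) (hF : HasDerivWithinAt F F' (Ici 0) 0) (hF0 : F 0 = 0)
    (h : ∀ t, 0 < t → HasDerivAt f (F t / t) t) : HasDerivWithinAt f F' (Ici 0) 0 := by
  refine hasDerivWithinAt_Ici_of_tendsto hf (g := slope F 0) ?_ fun t ht => ?_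
  · rw [hasDerivWithinAt_iff_tendsto_slope, Ici_sdiff_left] at hF
    exact hF
  · rw [slope_def_field, hF0, sub_zero, sub_zero]
    exact h t ht

/-! ### The integrals `∫ (x+t)^{-b} x^c e^{-x-t} dx` -/

/-- The kernel `(x+t)^{-b} x^c e^{-x-t}`, so that `weight lam bet gam = kernel (lam + bet) gam`. -/
def kernel (b c t x : ℝ) : ℝ := (x + t) ^ (-b) * x ^ c * Real.exp (-x - t)

/-- The integral of `kernel b c t` over `(0,∞)`. -/
def kernelInt (b c t : ℝ) : ℝ := ∫ x in Ioi (0 : ℝ), kernel b c t x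

/-- The parameters with `t ≥ 0` for which `kernel b c t` is integrable on `(0,∞)`. -/
def Admissible (b c t : ℝ) : Prop := (0 < t ∧ -1 < c) ∨ (t = 0 ∧ -1 < c - b)

theorem Admissible.nonneg {b c t : ℝ} (h : Admissible b c t) : 0 ≤ t := by
  rcases h with h | h
  · exact h.1.le
  · exact h.1.ge

theorem Admissible.add_nat {b c t : ℝ} (h : Admissible b c t) (k : ℕ) :
    Admissible b (c + k) t := by
  have : (0 : ℝ) ≤ k := k.cast_nonneg
  exact h.imp (fun h => ⟨h.1, by linarith [h.2]⟩) fun h => ⟨h.1, by linarith [h.2]⟩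

theorem Admissible.of_sub_one {b c t : ℝ} (h : Admissible b (c - 1) t) : Admissible b c t := by
  simpa using h.add_nat 1

theorem Admissible.add_one_left {b c t : ℝ} (h : Admissible b (c - 1) t) :
    Admissible (b + 1) c t :=
  h.imp (fun h => ⟨h.1, by linarith [h.2]⟩) fun h => ⟨h.1, by linarith [h.2]⟩

theorem kernel_pos (b c : ℝ) {t x : ℝ} (ht : 0 ≤ t) (hx : 0 < x) : 0 < kernel b c t x := by
  unfold kernel; positivity

theorem kernel_zero (b c : ℝ) {x : ℝ} (hx : 0 < x) :
    kernel b c 0 x = Real.exp (-x) * x ^ (c - b) := by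
  rw [kernel, add_zero, sub_zero, sub_eq_add_neg c, Real.rpow_add hx]
  ring

theorem kernel_add_nat (b c t : ℝ) {x : ℝ} (hx : 0 < x) (k : ℕ) :
    kernel b (c + k) t x = x ^ k * kernel b c t x := by
  rw [kernel, kernel, Real.rpow_add hx, Real.rpow_natCast]
  ring

theorem kernel_add_one_left (b c : ℝ) {t x : ℝ} (ht : 0 ≤ t) (hx : 0 < x) :
    (x + t) * kernel (b + 1) c t x = kernel b c t x := by
  have hxt : 0 < x + t := by positivity
  rw [kernel, kernel, show -b = -(b + 1) + 1 by ring, Real.rpow_add hxt, Real.rpow_one]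
  ring

theorem hasDerivAt_kernel (b c : ℝ) {t x : ℝ} (ht : 0 ≤ t) (hx : 0 < x) :
    HasDerivAt (kernel b c t)
      (c * kernel b (c - 1) t x - b * kernel (b + 1) c t x - kernel b c t x) x := by
  have hxt : x + t ≠ 0 := by positivity
  have hshift : HasDerivAt (fun x : ℝ => (x + t) ^ (-b)) (1 * (-b) * (x + t) ^ (-b - 1)) x :=
    ((hasDerivAt_id x).add_const t).rpow_const (Or.inl hxt)
  have hpow : HasDerivAt (fun x : ℝ => x ^ c) (c * x ^ (c - 1)) x :=
    Real.hasDerivAt_rpow_const (Or.inl hx.ne')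
  have hexp : HasDerivAt (fun x : ℝ => Real.exp (-x - t)) (Real.exp (-x - t) * (-1)) x :=
    ((hasDerivAt_id x).neg.sub_const t).exp
  refine ((hshift.mul hpow).mul hexp).congr_deriv ?_
  simp only [kernel, Pi.mul_apply, neg_add, ← sub_eq_add_neg]
  ring

theorem hasDerivAt_kernel_param (b c : ℝ) {t x : ℝ} (hxt : x + t ≠ 0) :
    HasDerivAt (fun s => kernel b c s x) (-kernel b c t x - b * kernel (b + 1) c t x) t := by
  have hshift : HasDerivAt (fun s : ℝ => (x + s) ^ (-b)) (1 * (-b) * (x + t) ^ (-b - 1)) t :=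
    ((hasDerivAt_id t).const_add x).rpow_const (Or.inl hxt)
  have hexp : HasDerivAt (fun s : ℝ => Real.exp (-x - s)) (Real.exp (-x - t) * (-1)) t :=
    ((hasDerivAt_id t).const_sub (-x)).exp
  refine ((hshift.mul_const (x ^ c)).mul hexp).congr_deriv ?_
  simp only [kernel, neg_add, ← sub_eq_add_neg]
  ring

theorem continuousOn_kernel (b c : ℝ) {t : ℝ} (ht : 0 ≤ t) :
    ContinuousOn (kernel b c t) (Ioi 0) :=
  fun _ hx => (hasDerivAt_kernel b c ht hx).continuousAt.continuousWithinAt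

theorem integrableOn_exp_neg_mul_rpow {s : ℝ} (hs : -1 < s) :
    IntegrableOn (fun x => Real.exp (-x) * x ^ s) (Ioi 0) := by
  simpa using Real.GammaIntegral_convergent (s := s + 1) (by linarith)

theorem integrableOn_kernel_of_le {b c t : ℝ} (ht : 0 ≤ t) {g : ℝ → ℝ}
    (hg : IntegrableOn g (Ioi 0)) (h : ∀ x, 0 < x → kernel b c t x ≤ g x) :
    IntegrableOn (kernel b c t) (Ioi 0) := by
  refine Integrable.mono' hg
    ((continuousOn_kernel b c ht).aestronglyMeasurable measurableSet_Ioi) ?_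
  refine (ae_restrict_iff' measurableSet_Ioi).2 (Eventually.of_forall fun x hx => ?_)
  rw [Real.norm_of_nonneg (kernel_pos b c ht hx).le]
  exact h x hx

theorem kernel_le_of_rpow_le (c : ℝ) {b t x B : ℝ} (ht : 0 ≤ t) (hx : 0 < x)
    (hB : (x + t) ^ (-b) ≤ B) : kernel b c t x ≤ B * (Real.exp (-x) * x ^ c) := by
  have hB0 : 0 ≤ B := le_trans (by positivity) hB
  have hexp : Real.exp (-x - t) ≤ Real.exp (-x) := Real.exp_le_exp.2 (by linarith)
  calc kernel b c t x ≤ B * x ^ c * Real.exp (-x) := by unfold kernel; gcongr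
    _ = B * (Real.exp (-x) * x ^ c) := by ring

theorem add_rpow_le_two_mul_rpow_add {p x y : ℝ} (hp : 0 ≤ p) (hx : 0 ≤ x) (hy : 0 ≤ y) :
    (x + y) ^ p ≤ (2 * x) ^ p + (2 * y) ^ p := by
  rcases le_total x y with hxy | hyx
  · exact (Real.rpow_le_rpow (by positivity) (by linarith) hp).trans
      (le_add_of_nonneg_left (by positivity))
  · exact (Real.rpow_le_rpow (by positivity) (by linarith) hp).trans
      (le_add_of_nonneg_right (by positivity))

theorem integrableOn_kernel {b c t : ℝ} (h : Admissible b c t) :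
    IntegrableOn (kernel b c t) (Ioi 0) := by
  rcases h with ⟨ht, hc⟩ | ⟨rfl, hc⟩
  · rcases le_total 0 b with hb | hb
    · refine integrableOn_kernel_of_le ht.le
        ((integrableOn_exp_neg_mul_rpow hc).const_mul (t ^ (-b))) fun x hx => ?_
      exact kernel_le_of_rpow_le c ht.le hx
        (Real.rpow_le_rpow_of_nonpos ht (by linarith) (by linarith))
    · refine integrableOn_kernel_of_le ht.le
        (((integrableOn_exp_neg_mul_rpow (s := c - b) (by linarith)).const_mul (2 ^ (-b))).add
          ((integrableOn_exp_neg_mul_rpow hc).const_mul ((2 * t) ^ (-b)))) fun x hx => ?_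
      refine (kernel_le_of_rpow_le c ht.le hx
        (add_rpow_le_two_mul_rpow_add (by linarith) hx.le ht.le)).trans_eq ?_
      rw [Pi.add_apply, Real.mul_rpow two_pos.le hx.le, sub_eq_add_neg c, Real.rpow_add hx]
      ring
  · exact (integrableOn_exp_neg_mul_rpow hc).congr_fun (fun x hx => (kernel_zero b c hx).symm)
      measurableSet_Ioi

theorem kernelInt_shift {b c t : ℝ} (h : Admissible (b + 1) c t) :
    kernelInt (b + 1) (c + 1) t + t * kernelInt (b + 1) c t = kernelInt b c t := by
  have h' : Admissible (b + 1) (c + 1) t := by simpa using h.add_nat 1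
  unfold kernelInt
  rw [← integral_const_mul,
    ← integral_add (integrableOn_kernel h') ((integrableOn_kernel h).const_mul t)]
  refine setIntegral_congr_fun measurableSet_Ioi fun x hx => ?_
  have hsucc := kernel_add_nat (b + 1) c t hx 1
  rw [Nat.cast_one, pow_one] at hsucc
  simp only [hsucc]
  rw [← add_mul, kernel_add_one_left b c h.nonneg hx]

theorem kernelInt_zero {b c : ℝ} (h : -1 < c - b) : kernelInt b c 0 = Real.Gamma (c - b + 1) := by
  rw [Real.Gamma_eq_integral (by linarith), add_sub_cancel_right]
  exact setIntegral_congr_fun measurableSet_Ioi fun x hx => kernel_zero b c hx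

theorem kernelInt_zero_add_one {b c : ℝ} (h : -1 < c - b) :
    kernelInt b (c + 1) 0 = (c - b + 1) * kernelInt b c 0 := by
  rw [kernelInt_zero h, kernelInt_zero (by linarith), ← Real.Gamma_add_one (by linarith)]
  congr 1
  ring

theorem kernelInt_by_parts_of_pos (b : ℝ) {c t : ℝ} (ht : 0 < t) (hc : 0 < c) :
    c * kernelInt b (c - 1) t = b * kernelInt (b + 1) c t + kernelInt b c t := by
  have i1 := (integrableOn_kernel (b := b) (c := c - 1) (Or.inl ⟨ht, by linarith⟩)).const_mul c
  have i2 := (integrableOn_kernel (b := b + 1) (c := c) (Or.inl ⟨ht, by linarith⟩)).const_mul b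
  have i3 := integrableOn_kernel (b := b) (c := c) (Or.inl ⟨ht, by linarith⟩)
  have hderiv : ∀ x ∈ Ioi (0 : ℝ), HasDerivAt (kernel b c t) _ x :=
    fun x hx => hasDerivAt_kernel b c ht.le hx
  have hzero : kernel b c t 0 = 0 := by simp [kernel, Real.zero_rpow hc.ne']
  have hcont : ContinuousWithinAt (kernel b c t) (Ici 0) 0 := by
    have hshift : ContinuousAt (fun x : ℝ => (x + t) ^ (-b)) 0 :=
      (continuousAt_id.add continuousAt_const).rpow_const (Or.inl (by simpa using ht.ne'))
    have hpow : ContinuousAt (fun x : ℝ => x ^ c) 0 := continuousAt_id.rpow_const (Or.inr hc.le)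
    exact ((hshift.mul hpow).mul (by fun_prop)).continuousWithinAt
  have hFTC := integral_Ioi_of_hasDerivAt_of_tendsto hcont hderiv ((i1.sub i2).sub i3)
    (tendsto_zero_of_hasDerivAt_of_integrableOn_Ioi hderiv ((i1.sub i2).sub i3) i3)
  have hsub := integral_sub (i1.sub i2) i3
  have hsub' := integral_sub i1 i2
  simp only [Pi.sub_apply, integral_const_mul] at hsub hsub'
  rw [hsub, hsub', hzero, sub_zero] at hFTC
  unfold kernelInt
  linarith

theorem kernelInt_by_parts {b c t : ℝ} (h : Admissible b (c - 1) t) :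
    c * kernelInt b (c - 1) t = b * kernelInt (b + 1) c t + kernelInt b c t := by
  rcases h with ⟨ht, hc⟩ | ⟨rfl, hc⟩
  · exact kernelInt_by_parts_of_pos b ht (by linarith)
  · have hsucc := kernelInt_zero_add_one hc
    have hdiag : kernelInt (b + 1) c 0 = kernelInt b (c - 1) 0 := by
      rw [kernelInt_zero hc, kernelInt_zero (by linarith)]
      congr 1
      ring
    rw [sub_add_cancel] at hsucc
    rw [hsucc, hdiag]
    ring

theorem rpow_le_add_rpow (p : ℝ) {u v w : ℝ} (hu : 0 < u) (huv : u ≤ v) (hvw : v ≤ w) :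
    v ^ p ≤ u ^ p + w ^ p := by
  have hv := hu.trans_le huv
  have hw := hv.trans_le hvw
  rcases le_total 0 p with hp | hp
  · exact (Real.rpow_le_rpow hv.le hvw hp).trans (le_add_of_nonneg_left (by positivity))
  · exact (Real.rpow_le_rpow_of_nonpos hu huv hp).trans (le_add_of_nonneg_right (by positivity))

theorem kernel_le (b c : ℝ) {u s v x : ℝ} (hu : 0 ≤ u) (hus : u ≤ s) (hsv : s ≤ v) (hx : 0 < x) :
    kernel b c s x ≤ Real.exp u * kernel b c u x + Real.exp v * kernel b c v x := by
  have hexp : ∀ τ, Real.exp τ * kernel b c τ x = (x + τ) ^ (-b) * (Real.exp (-x) * x ^ c) := by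
    intro τ
    rw [kernel, sub_eq_add_neg, Real.exp_add, Real.exp_neg τ]
    field_simp
  rw [hexp, hexp, ← add_mul]
  exact kernel_le_of_rpow_le c (hu.trans hus) hx
    (rpow_le_add_rpow (-b) (by positivity) (by linarith) (by linarith))

theorem hasDerivAt_kernelInt (b : ℝ) {c t : ℝ} (ht : 0 < t) (hc : -1 < c) :
    HasDerivAt (kernelInt b c) (-kernelInt b c t - b * kernelInt (b + 1) c t) t := by
  have hint : ∀ (b' : ℝ) {s : ℝ}, 0 < s → IntegrableOn (kernel b' c s) (Ioi 0) :=
    fun b' s hs => integrableOn_kernel (Or.inl ⟨hs, hc⟩)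
  set bound : ℝ → ℝ → ℝ := fun b' x =>
    Real.exp (t / 2) * kernel b' c (t / 2) x + Real.exp (2 * t) * kernel b' c (2 * t) x
  have hboundInt : ∀ b', IntegrableOn (bound b') (Ioi 0) := fun b' =>
    ((hint b' (by positivity)).const_mul _).add ((hint b' (by positivity)).const_mul _)
  have hle : ∀ b', ∀ x ∈ Ioi (0 : ℝ), ∀ s ∈ Ioo (t / 2) (2 * t),
      ‖kernel b' c s x‖ ≤ bound b' x := by
    intro b' x hx s hs
    rw [Real.norm_of_nonneg (kernel_pos b' c (by linarith [hs.1]) hx).le]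
    exact kernel_le b' c (by positivity) hs.1.le hs.2.le hx
  have hnhds : Ioo (t / 2) (2 * t) ∈ 𝓝 t := Ioo_mem_nhds (by linarith) (by linarith)
  have key := (hasDerivAt_integral_of_dominated_loc_of_deriv_le (μ := volume.restrict (Ioi 0))
    (F := fun s x => kernel b c s x) (F' := fun s x => -kernel b c s x - b * kernel (b + 1) c s x)
    (bound := fun x => bound b x + |b| * bound (b + 1) x) hnhds ?_ (hint b ht) ?_ ?_ ?_ ?_).2
  · have hsub := integral_sub (hint b ht).neg ((hint (b + 1) ht).const_mul b)
    simp only [Pi.neg_apply, integral_neg, integral_const_mul] at hsub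
    rwa [hsub] at key
  · filter_upwards [hnhds] with s hs
    exact (hint b (by linarith [hs.1])).aestronglyMeasurable
  · exact ((hint b ht).neg.sub ((hint (b + 1) ht).const_mul b)).aestronglyMeasurable
  · refine (ae_restrict_iff' measurableSet_Ioi).2 (Eventually.of_forall fun x hx s hs => ?_)
    refine (norm_sub_le _ _).trans (add_le_add ?_ ?_)
    · rw [norm_neg]
      exact hle b x hx s hs
    · rw [norm_mul, Real.norm_eq_abs]
      exact mul_le_mul_of_nonneg_left (hle (b + 1) x hx s hs) (abs_nonneg b)
  · exact (hboundInt b).add ((hboundInt (b + 1)).const_mul _)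
  · refine (ae_restrict_iff' measurableSet_Ioi).2 (Eventually.of_forall fun x hx s hs => ?_)
    exact hasDerivAt_kernel_param b c (add_pos hx (by linarith [hs.1])).ne'

theorem contDiffOn_kernelInt {c : ℝ} (hc : -1 < c) (m : ℕ) :
    ∀ b : ℝ, ContDiffOn ℝ m (kernelInt b c) (Ioi 0) := by
  induction m with
  | zero =>
    exact fun b => contDiffOn_zero.2 fun x hx =>
      (hasDerivAt_kernelInt b hx hc).continuousAt.continuousWithinAt
  | succ m ih =>
    intro b
    rw [Nat.cast_succ, contDiffOn_succ_iff_deriv_of_isOpen isOpen_Ioi]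
    refine ⟨fun x hx => (hasDerivAt_kernelInt b hx hc).differentiableAt.differentiableWithinAt,
      by simp, ?_⟩
    exact ((ih b).neg.sub (contDiffOn_const.mul (ih (b + 1)))).congr fun x hx =>
      (hasDerivAt_kernelInt b hx hc).deriv

theorem continuousWithinAt_kernelInt_zero {b c : ℝ} (hc : -1 < c) (hcb : -1 < c - b) :
    ContinuousWithinAt (kernelInt b c) (Ici 0) 0 := by
  have hmem : Icc (0 : ℝ) 1 ∈ 𝓝[Ici 0] (0 : ℝ) := Icc_mem_nhdsGE one_pos
  refine continuousWithinAt_of_dominated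
    (bound := fun x => Real.exp 0 * kernel b c 0 x + Real.exp 1 * kernel b c 1 x) ?_ ?_ ?_ ?_
  · filter_upwards [hmem] with s hs
    exact (continuousOn_kernel b c hs.1).aestronglyMeasurable measurableSet_Ioi
  · filter_upwards [hmem] with s hs
    refine (ae_restrict_iff' measurableSet_Ioi).2 (Eventually.of_forall fun x hx => ?_)
    rw [Real.norm_of_nonneg (kernel_pos b c hs.1 hx).le]
    exact kernel_le b c le_rfl hs.1 hs.2 hx
  · exact ((integrableOn_kernel (Or.inr ⟨rfl, hcb⟩)).const_mul _).add
      ((integrableOn_kernel (Or.inl ⟨one_pos, hc⟩)).const_mul _)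
  · refine (ae_restrict_iff' measurableSet_Ioi).2 (Eventually.of_forall fun x hx => ?_)
    have hx0 : x + 0 ≠ 0 := by simpa using (mem_Ioi.1 hx).ne'
    exact (hasDerivAt_kernel_param b c hx0).continuousAt.continuousWithinAt

theorem differentiableWithinAt_kernelInt_zero {b c : ℝ} (hc : -1 < c) (hcb : 0 < c - b) :
    DifferentiableWithinAt ℝ (kernelInt b c) (Ici 0) 0 := by
  have h0 := continuousWithinAt_kernelInt_zero (b := b) hc (by linarith)
  have h1 := continuousWithinAt_kernelInt_zero (b := b + 1) hc (by linarith)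
  exact (hasDerivWithinAt_Ici_of_tendsto h0
    ((h0.neg.sub (h1.const_mul b)).mono Ioi_subset_Ici_self)
    fun x hx => hasDerivAt_kernelInt b hx hc).differentiableWithinAt

/-! ### Monic orthogonal polynomials of a linear functional -/

section OrthogonalPolynomials

variable {K : Type*} [Field K] {L : K[X] →ₗ[K] K} {P : ℕ → K[X]}

theorem linearMap_C_mul (L : K[X] →ₗ[K] K) (c : K) (q : K[X]) : L (C c * q) = c * L q := by
  rw [← smul_eq_C_mul, map_smul, smul_eq_mul]

theorem linearMap_eq_sum (L : K[X] →ₗ[K] K) {q : K[X]} {N : ℕ} (h : q.natDegree < N) :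
    L q = ∑ k ∈ Finset.range N, q.coeff k * L (X ^ k) := by
  conv_lhs => rw [as_sum_range_C_mul_X_pow' q h, map_sum]
  simp only [linearMap_C_mul]

theorem linearMap_mul_eq_sum (L : K[X] →ₗ[K] K) {p q : K[X]} {n : ℕ} (hp : p.natDegree < n)
    (hq : q.natDegree < n) :
    L (p * q) =
      ∑ l : Fin n, (∑ k : Fin n, p.coeff k * L (X ^ ((k : ℕ) + (l : ℕ)))) * q.coeff l := by
  have hmul : ∀ l, L (p * X ^ l) = ∑ k ∈ Finset.range n, p.coeff k * L (X ^ (k + l)) := by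
    intro l
    conv_lhs => rw [as_sum_range_C_mul_X_pow' p hp, Finset.sum_mul, map_sum]
    simp only [mul_assoc, ← pow_add, linearMap_C_mul]
  conv_lhs => rw [as_sum_range_C_mul_X_pow' q hq, Finset.mul_sum, map_sum]
  simp only [mul_left_comm p, linearMap_C_mul, hmul, Finset.sum_range, mul_comm (q.coeff _)]

theorem linearMap_ext_X_pow {L M : K[X] →ₗ[K] K} (h : ∀ k : ℕ, L (X ^ k) = M (X ^ k)) :
    L = M := by
  refine LinearMap.ext fun q => ?_
  rw [linearMap_eq_sum L (Nat.lt_succ_self _), linearMap_eq_sum M (Nat.lt_succ_self _)]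
  simp only [h]

/-- The monic Gram–Schmidt process for the bilinear form `(p, q) ↦ L (p q)`, applied to
`1, X, X², …`. -/
def orthoPoly (L : K[X] →ₗ[K] K) (n : ℕ) : K[X] :=
  X ^ n - ∑ j : Fin n, C (L (X ^ n * orthoPoly L j) / L (orthoPoly L j ^ 2)) * orthoPoly L j
termination_by n
decreasing_by all_goals exact j.isLt

/-- `P` is the sequence of monic orthogonal polynomials of the functional `L`, every `L (P n ^ 2)`
being nonzero. -/
structure IsMonicOrthogonal (L : K[X] →ₗ[K] K) (P : ℕ → K[X]) : Prop where
  monic : ∀ n, (P n).Monic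
  natDegree_eq : ∀ n, (P n).natDegree = n
  ne_zero : ∀ n, L (P n ^ 2) ≠ 0
  orthogonal : ∀ m n, m ≠ n → L (P m * P n) = 0

theorem monic_natDegree_orthoPoly (L : K[X] →ₗ[K] K) (n : ℕ) :
    (orthoPoly L n).Monic ∧ (orthoPoly L n).natDegree = n := by
  induction n using Nat.strong_induction_on with
  | _ n ih =>
    have hdeg : (∑ j : Fin n, C (L (X ^ n * orthoPoly L j) / L (orthoPoly L j ^ 2)) *
        orthoPoly L j).degree < n := by
      refine (degree_sum_le _ _).trans_lt ((Finset.sup_lt_iff (WithBot.bot_lt_coe n)).2 ?_)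
      intro j _
      rw [← smul_eq_C_mul]
      refine (degree_smul_le _ _).trans_lt ?_
      rw [degree_eq_natDegree (ih j j.isLt).1.ne_zero, (ih j j.isLt).2]
      exact WithBot.coe_lt_coe.2 j.isLt
    rw [orthoPoly]
    refine ⟨monic_X_pow_sub hdeg, ?_⟩
    refine natDegree_eq_of_degree_eq_some ?_
    rw [degree_sub_eq_left_of_degree_lt (by rwa [degree_X_pow]), degree_X_pow]

theorem isMonicOrthogonal_orthoPoly (h : ∀ n, L (orthoPoly L n ^ 2) ≠ 0) :
    IsMonicOrthogonal L (orthoPoly L) := by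
  have key : ∀ n, ∀ m < n, L (orthoPoly L n * orthoPoly L m) = 0 := by
    intro n
    induction n using Nat.strong_induction_on with
    | _ n ih =>
      intro m hm
      rw [orthoPoly, sub_mul, Finset.sum_mul, map_sub, map_sum,
        Finset.sum_eq_single (⟨m, hm⟩ : Fin n)]
      · rw [mul_assoc, linearMap_C_mul, ← sq, div_mul_cancel₀ _ (h m), sub_self]
      · intro j _ hj
        have hne : (j : ℕ) ≠ m := fun h => hj (Fin.ext h)
        rw [mul_assoc, linearMap_C_mul]
        rcases lt_or_gt_of_ne hne with hlt | hgt
        · rw [mul_comm (orthoPoly L j), ih m hm j hlt, mul_zero]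
        · rw [ih j j.isLt m hgt, mul_zero]
      · simp
  refine ⟨fun n => (monic_natDegree_orthoPoly L n).1, fun n => (monic_natDegree_orthoPoly L n).2,
    h, fun m n hmn => ?_⟩
  rcases lt_or_gt_of_ne hmn with hlt | hgt
  · rw [mul_comm, key n m hlt]
  · exact key m n hgt

theorem coeff_X_mul_derivative (q : K[X]) (k : ℕ) :
    (X * derivative q).coeff k = k * q.coeff k := by
  cases k with
  | zero => simp
  | succ k => rw [coeff_X_mul, coeff_derivative]; push_cast; ring

theorem natDegree_X_mul_derivative_le (q : K[X]) : (X * derivative q).natDegree ≤ q.natDegree :=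
  natDegree_le_iff_coeff_eq_zero.2 fun k hk => by
    rw [coeff_X_mul_derivative, coeff_eq_zero_of_natDegree_lt hk, mul_zero]

theorem natDegree_X_mul_derivative_sub_le {q : K[X]} {n : ℕ} (hq : q.natDegree ≤ n + 1) :
    (X * derivative q - C (n + 1 : K) * q).natDegree ≤ n := by
  refine natDegree_le_iff_coeff_eq_zero.2 fun k hk => ?_
  rw [coeff_sub, coeff_X_mul_derivative, coeff_C_mul]
  rcases (Nat.succ_le_of_lt hk).eq_or_lt with rfl | hk'
  · push_cast
    ring
  · rw [coeff_eq_zero_of_natDegree_lt (hq.trans_lt hk')]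
    ring

/-- The diagonal coefficient of the three-term recurrence of the monic polynomials `P`. -/
def recAlpha (P : ℕ → K[X]) (n : ℕ) : K := (P n).nextCoeff - (P (n + 1)).nextCoeff

/-- The off-diagonal coefficient `L(P_n²) / L(P_{n-1}²)` of the three-term recurrence, with value
`0` at `n = 0`. -/
def recBeta (L : K[X] →ₗ[K] K) (P : ℕ → K[X]) : ℕ → K
  | 0 => 0
  | n + 1 => L (P (n + 1) ^ 2) / L (P n ^ 2)

namespace IsMonicOrthogonal

theorem coeff_self (hP : IsMonicOrthogonal L P) (n : ℕ) : (P n).coeff n = 1 := by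
  have := (hP.monic n).coeff_natDegree
  rwa [hP.natDegree_eq] at this

theorem coeff_eq_zero (hP : IsMonicOrthogonal L P) {n k : ℕ} (h : n < k) : (P n).coeff k = 0 :=
  coeff_eq_zero_of_natDegree_lt (by rwa [hP.natDegree_eq])

theorem coeff_succ (hP : IsMonicOrthogonal L P) (n : ℕ) :
    (P (n + 1)).coeff n = (P (n + 1)).nextCoeff := by
  rw [nextCoeff_of_natDegree_pos (by rw [hP.natDegree_eq]; omega), hP.natDegree_eq,
    Nat.add_sub_cancel]

theorem nextCoeff_zero (hP : IsMonicOrthogonal L P) : (P 0).nextCoeff = 0 := by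
  simp [nextCoeff, hP.natDegree_eq]

theorem eq_one (hP : IsMonicOrthogonal L P) : P 0 = 1 :=
  (hP.monic 0).natDegree_eq_zero.1 (hP.natDegree_eq 0)

theorem degree_sub_C_coeff_mul_lt (hP : IsMonicOrthogonal L P) {n : ℕ} {q : K[X]}
    (hq : q.natDegree ≤ n) : (q - C (q.coeff n) * P n).degree < n := by
  rw [degree_lt_iff_coeff_zero]
  intro m hm
  rw [coeff_sub, coeff_C_mul]
  rcases hm.eq_or_lt with rfl | hm
  · rw [hP.coeff_self, mul_one, sub_self]
  · rw [hP.coeff_eq_zero hm, coeff_eq_zero_of_natDegree_lt (hq.trans_lt hm), mul_zero, sub_zero]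

theorem map_mul_of_degree_lt (hP : IsMonicOrthogonal L P) {n : ℕ} {q : K[X]}
    (hq : q.degree < n) : L (P n * q) = 0 := by
  suffices ∀ d ≤ n, ∀ q : K[X], q.degree < d → L (P n * q) = 0 from this n le_rfl q hq
  intro d
  induction d with
  | zero =>
    intro _ q hq
    rw [degree_eq_bot.1 (Nat.WithBot.lt_zero_iff.1 hq), mul_zero, map_zero]
  | succ d ih =>
    intro hd q hq
    have hdeg : q.natDegree ≤ d := natDegree_le_iff_coeff_eq_zero.2 fun m hm =>
      (degree_lt_iff_coeff_zero q (d + 1)).1 hq m hm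
    have hrem := ih (by omega) _ (hP.degree_sub_C_coeff_mul_lt hdeg)
    rwa [mul_sub, map_sub, mul_left_comm, linearMap_C_mul, hP.orthogonal n d (by omega), mul_zero,
      sub_zero] at hrem

theorem map_mul_of_natDegree_le (hP : IsMonicOrthogonal L P) {n : ℕ} {q : K[X]}
    (hq : q.natDegree ≤ n) : L (P n * q) = q.coeff n * L (P n ^ 2) := by
  have hrem := hP.map_mul_of_degree_lt (hP.degree_sub_C_coeff_mul_lt hq)
  rwa [mul_sub, map_sub, mul_left_comm, linearMap_C_mul, ← sq, sub_eq_zero] at hrem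

theorem map_mul_of_natDegree_lt (hP : IsMonicOrthogonal L P) {n : ℕ} {q : K[X]}
    (hq : q.natDegree < n) : L (P n * q) = 0 := by
  rw [hP.map_mul_of_natDegree_le hq.le, coeff_eq_zero_of_natDegree_lt hq, zero_mul]

theorem eq_zero_of_map_mul (hP : IsMonicOrthogonal L P) {q : K[X]}
    (h : ∀ j ≤ q.natDegree, L (P j * q) = 0) : q = 0 := by
  have hlead := h _ le_rfl
  rw [hP.map_mul_of_natDegree_le le_rfl] at hlead
  exact leadingCoeff_eq_zero.1 ((mul_eq_zero.1 hlead).resolve_right (hP.ne_zero _))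

theorem natDegree_X_mul (hP : IsMonicOrthogonal L P) (n : ℕ) : (X * P n).natDegree = n + 1 := by
  rw [Polynomial.natDegree_X_mul (hP.monic n).ne_zero, hP.natDegree_eq]

theorem natDegree_X_mul_sub_le (hP : IsMonicOrthogonal L P) (n : ℕ) :
    (X * P n - P (n + 1)).natDegree ≤ n := by
  refine natDegree_le_iff_coeff_eq_zero.2 fun k hk => ?_
  rw [coeff_sub]
  rcases (Nat.succ_le_of_lt hk).eq_or_lt with rfl | hk'
  · rw [Nat.succ_eq_add_one, coeff_X_mul, hP.coeff_self, hP.coeff_self, sub_self]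
  · rw [hP.coeff_eq_zero hk', coeff_eq_zero_of_natDegree_lt (by rwa [hP.natDegree_X_mul]), sub_zero]

theorem coeff_X_mul_sub (hP : IsMonicOrthogonal L P) (n : ℕ) :
    (X * P n - P (n + 1)).coeff n = recAlpha P n := by
  rw [coeff_sub, recAlpha, hP.coeff_succ]
  cases n with
  | zero => rw [coeff_X_mul_zero, hP.nextCoeff_zero]
  | succ n => rw [coeff_X_mul, hP.coeff_succ]

theorem map_X_mul_sq (hP : IsMonicOrthogonal L P) (n : ℕ) :
    L (X * P n ^ 2) = recAlpha P n * L (P n ^ 2) := by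
  rw [← hP.coeff_X_mul_sub, ← hP.map_mul_of_natDegree_le (hP.natDegree_X_mul_sub_le n), mul_sub,
    map_sub, hP.orthogonal n (n + 1) (by omega), sub_zero]
  congr 1
  ring

theorem map_X_mul_mul_succ (hP : IsMonicOrthogonal L P) (n : ℕ) :
    L (X * (P (n + 1) * P n)) = L (P (n + 1) ^ 2) := by
  rw [mul_left_comm, hP.map_mul_of_natDegree_le (hP.natDegree_X_mul n).le, coeff_X_mul,
    hP.coeff_self, one_mul]

theorem map_derivative_sq (hP : IsMonicOrthogonal L P) (n : ℕ) :
    L (derivative (P n ^ 2)) = 0 := by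
  have hdeg : (derivative (P n)).degree < n := by
    have := degree_derivative_lt (hP.monic n).ne_zero
    rwa [degree_eq_natDegree (hP.monic n).ne_zero, hP.natDegree_eq] at this
  rw [derivative_sq, mul_assoc, linearMap_C_mul, hP.map_mul_of_degree_lt hdeg, mul_zero]

theorem map_derivative_mul_succ (hP : IsMonicOrthogonal L P) (n : ℕ) :
    L (derivative (P (n + 1) * P n)) = (n + 1) * L (P n ^ 2) := by
  have hdeg : ∀ m, (derivative (P m)).natDegree ≤ m - 1 := fun m => by
    simpa only [hP.natDegree_eq] using natDegree_derivative_le (P m)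
  rw [derivative_mul, map_add, mul_comm (derivative _),
    hP.map_mul_of_natDegree_le (n := n) (hdeg (n + 1)), coeff_derivative, hP.coeff_self,
    hP.map_mul_of_natDegree_lt (by have := hdeg n; omega), add_zero, one_mul]

theorem map_derivative_X_mul_sq (hP : IsMonicOrthogonal L P) (n : ℕ) :
    L (derivative (X * P n ^ 2)) = (2 * n + 1) * L (P n ^ 2) := by
  have hexpand : derivative (X * P n ^ 2) = P n ^ 2 + C 2 * (P n * (X * derivative (P n))) := by
    rw [derivative_mul, derivative_sq, derivative_X]
    ring
  rw [hexpand, map_add, linearMap_C_mul, hP.map_mul_of_natDegree_le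
      ((natDegree_X_mul_derivative_le _).trans (hP.natDegree_eq n).le),
    coeff_X_mul_derivative, hP.coeff_self]
  ring

theorem map_derivative_X_mul_mul_succ (hP : IsMonicOrthogonal L P) (n : ℕ) :
    L (derivative (X * (P (n + 1) * P n))) = -(P (n + 1)).nextCoeff * L (P n ^ 2) := by
  have hexpand : derivative (X * (P (n + 1) * P n)) =
      C (n + 2 : K) * (P (n + 1) * P n) +
        P n * (X * derivative (P (n + 1)) - C (n + 1 : K) * P (n + 1)) +
        P (n + 1) * (X * derivative (P n)) := by
    rw [derivative_mul, derivative_mul, derivative_X]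
    simp only [C_add, C_1, show C (2 : K) = 2 from rfl]
    ring
  rw [hexpand, map_add, map_add, linearMap_C_mul, hP.orthogonal (n + 1) n (by omega),
    hP.map_mul_of_natDegree_le (natDegree_X_mul_derivative_sub_le (hP.natDegree_eq (n + 1)).le),
    hP.map_mul_of_natDegree_lt
      ((natDegree_X_mul_derivative_le _).trans_lt (by rw [hP.natDegree_eq]; omega)),
    coeff_sub, coeff_X_mul_derivative, coeff_C_mul, hP.coeff_succ]
  ring

theorem natDegree_recurrence_remainder_le (hP : IsMonicOrthogonal L P) (n : ℕ) (β : K) :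
    (X * P (n + 1) - P (n + 2) - C (recAlpha P (n + 1)) * P (n + 1) - C β * P n).natDegree ≤ n := by
  refine natDegree_le_iff_coeff_eq_zero.2 fun k hk => ?_
  rw [coeff_sub, coeff_sub, coeff_C_mul, coeff_C_mul, hP.coeff_eq_zero hk, mul_zero, sub_zero]
  rcases (Nat.succ_le_of_lt hk).eq_or_lt with rfl | hk'
  · rw [Nat.succ_eq_add_one, hP.coeff_X_mul_sub, hP.coeff_self, mul_one, sub_self]
  · rw [coeff_eq_zero_of_natDegree_lt ((hP.natDegree_X_mul_sub_le (n + 1)).trans_lt hk'),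
      hP.coeff_eq_zero hk', mul_zero, sub_zero]

/-- At `n = 0` the last term vanishes because `recBeta L P 0 = 0`, so the junk index `0 - 1 = 0` is
harmless. -/
theorem X_mul (hP : IsMonicOrthogonal L P) (n : ℕ) :
    X * P n = P (n + 1) + C (recAlpha P n) * P n + C (recBeta L P n) * P (n - 1) := by
  cases n with
  | zero =>
    have hconst : X * P 0 - P 1 = C (recAlpha P 0) := by
      rw [← hP.coeff_X_mul_sub 0]
      exact eq_C_of_natDegree_le_zero (hP.natDegree_X_mul_sub_le 0)
    rw [hP.eq_one, mul_one] at hconst ⊢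
    rw [recBeta, C_0, zero_mul, add_zero, mul_one, ← hconst]
    ring
  | succ n =>
    have hrem : X * P (n + 1) - P (n + 2) - C (recAlpha P (n + 1)) * P (n + 1)
        - C (recBeta L P (n + 1)) * P n = 0 := by
      refine hP.eq_zero_of_map_mul fun j hj => ?_
      have hj := hj.trans (hP.natDegree_recurrence_remainder_le n _)
      have hshift : L (P j * (X * P (n + 1))) = (P j).coeff n * L (P (n + 1) ^ 2) := by
        rw [show P j * (X * P (n + 1)) = P (n + 1) * (X * P j) by ring,
          hP.map_mul_of_natDegree_le (by rw [hP.natDegree_X_mul]; omega), coeff_X_mul]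
      rw [mul_sub, mul_sub, mul_sub, map_sub, map_sub, map_sub,
        hP.orthogonal j (n + 2) (by omega), mul_left_comm (P j) (C _), linearMap_C_mul,
        hP.orthogonal j (n + 1) (by omega), mul_left_comm (P j) (C _), linearMap_C_mul, hshift]
      rcases hj.eq_or_lt with rfl | hj'
      · rw [hP.coeff_self, ← sq, recBeta, div_mul_cancel₀ _ (hP.ne_zero j)]
        ring
      · rw [hP.coeff_eq_zero hj', hP.orthogonal j n (by omega)]
        ring
    rw [Nat.add_sub_cancel]
    linear_combination hrem

theorem det_hankel (hP : IsMonicOrthogonal L P) (n : ℕ) :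
    (Matrix.of fun j k : Fin n => L (X ^ ((j : ℕ) + (k : ℕ)))).det =
      ∏ j ∈ Finset.range n, L (P j ^ 2) := by
  set M : Matrix (Fin n) (Fin n) K := Matrix.of fun j k => L (X ^ ((j : ℕ) + (k : ℕ))) with hM
  set T : Matrix (Fin n) (Fin n) K := Matrix.of fun j k => (P j).coeff k with hT
  have hTdet : T.det = 1 := by
    rw [Matrix.det_of_isLowerTriangular]
    · exact Finset.prod_eq_one fun i _ => hP.coeff_self i
    · exact fun i j hij => hP.coeff_eq_zero (by simpa using hij)
  have hGram : T * M * T.transpose = Matrix.diagonal fun j : Fin n => L (P j ^ 2) := by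
    ext i j
    have hentry : (T * M * T.transpose) i j = L (P i * P j) := by
      rw [linearMap_mul_eq_sum L (n := n) (by rw [hP.natDegree_eq]; exact i.isLt)
        (by rw [hP.natDegree_eq]; exact j.isLt)]
      simp only [Matrix.mul_apply, Matrix.transpose_apply, hT, hM, Matrix.of_apply]
    rw [hentry, Matrix.diagonal_apply]
    split_ifs with hij
    · rw [hij, sq]
    · exact hP.orthogonal _ _ fun h => hij (Fin.ext h)
  have hdet := congrArg Matrix.det hGram
  rw [Matrix.det_mul, Matrix.det_mul, Matrix.det_transpose, hTdet, Matrix.det_diagonal, one_mul,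
    mul_one] at hdet
  rw [hdet, Fin.prod_univ_eq_prod_range (fun j => L (P j ^ 2))]

theorem map_pole_mul (hP : IsMonicOrthogonal L P) {N : K[X] →ₗ[K] K} {s : K}
    (hN : ∀ q, N ((X + C s) * q) = L q) {n : ℕ} {q : K[X]} (hq : q.natDegree ≤ n) :
    N (P n * q) = q.eval (-s) * N (P n) := by
  have hdiv : C (q.eval (-s)) + (X + C s) * (q /ₘ (X - C (-s))) = q := by
    have := modByMonic_add_div q (X - C (-s))
    rw [modByMonic_X_sub_C_eq_C_eval] at this
    simpa using this
  have hquot : L (P n * (q /ₘ (X - C (-s)))) = 0 := by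
    rcases eq_or_ne q 0 with rfl | hq0
    · rw [zero_divByMonic, mul_zero, map_zero]
    · refine hP.map_mul_of_degree_lt ((degree_divByMonic_lt _ _ hq0 ?_).trans_le
        (degree_le_of_natDegree_le hq))
      rw [degree_X_sub_C]
      exact zero_lt_one
  calc N (P n * q)
      = N (C (q.eval (-s)) * P n + (X + C s) * (P n * (q /ₘ (X - C (-s))))) := by
        congr 1
        linear_combination -P n * hdiv
    _ = q.eval (-s) * N (P n) := by rw [map_add, hN, hquot, linearMap_C_mul, add_zero]

/-- Each of the four factors is `q(-s) N (P m)` with `q, P m ∈ {P n, P (n + 1)}`; in the second one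
`L (P n ^ 2) = N ((X + C s) * P n ^ 2)` lowers the degree so that `map_pole_mul` applies. -/
theorem pole_identity (hP : IsMonicOrthogonal L P) {N : K[X] →ₗ[K] K} {s : K}
    (hN : ∀ q, N ((X + C s) * q) = L q) (n : ℕ) :
    N (P (n + 1) * P n) * (N (P (n + 1) * P n) - L (P n ^ 2)) =
      N (P (n + 1) ^ 2) * N (P n ^ 2) := by
  have hlow := hP.map_pole_mul hN (n := n + 1) (q := P n) (by rw [hP.natDegree_eq]; omega)
  have htop := hP.map_pole_mul hN (n := n + 1) (q := P (n + 1)) (hP.natDegree_eq _).le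
  have hdiag := hP.map_pole_mul hN (n := n) (q := P n) (hP.natDegree_eq n).le
  have hdeg : (P (n + 1) - (X + C s) * P n).natDegree ≤ n := by
    rw [show P (n + 1) - (X + C s) * P n = -(X * P n - P (n + 1)) - C s * P n by ring]
    refine (natDegree_sub_le _ _).trans (max_le ?_ ?_)
    · rw [natDegree_neg]
      exact hP.natDegree_X_mul_sub_le n
    · exact (natDegree_C_mul_le _ _).trans (hP.natDegree_eq n).le
  have hcross : N (P (n + 1) * P n) - L (P n ^ 2) = (P (n + 1)).eval (-s) * N (P n) := by
    have h := hP.map_pole_mul hN hdeg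
    simp only [eval_sub, eval_mul, eval_add, eval_X, eval_C, neg_add_cancel, zero_mul,
      sub_zero] at h
    rw [← h, ← hN, ← map_sub]
    congr 1
    ring
  rw [hcross, sq, sq, hlow, htop, hdiag]
  ring

end IsMonicOrthogonal

end OrthogonalPolynomials

/-! ### Ladder relations -/

section Ladder

variable {K : Type*} [Field K] {a gam t : K} {L N S : K[X] →ₗ[K] K} {P : ℕ → K[X]}

/-- The algebra of integration against `w`, `w / x` and `w / (x + t)`, performed by `L`, `N` and
`S`, for `w = (x+t)^{-a} x^γ e^{-x-t}`; the last field is integration by parts. -/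
structure IsLaguerreTriple (a gam t : K) (L N S : K[X] →ₗ[K] K) : Prop where
  map_X_mul : ∀ q, N (X * q) = L q
  map_X_add_mul : ∀ q, S ((X + C t) * q) = L q
  map_derivative : ∀ q, L (derivative q) = a * S q - gam * N q + L q

/-- The ladder quantity `R_n = γ N(P_n²) / L(P_n²)`. -/
def ladderR (gam : K) (L N : K[X] →ₗ[K] K) (P : ℕ → K[X]) (n : ℕ) : K :=
  gam * N (P n ^ 2) / L (P n ^ 2)

/-- The ladder quantity `r_n = γ N(P_n P_{n-1}) / L(P_{n-1}²)`, with value `0` at `n = 0`. -/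
def ladderS (gam : K) (L N : K[X] →ₗ[K] K) (P : ℕ → K[X]) : ℕ → K
  | 0 => 0
  | n + 1 => gam * N (P (n + 1) * P n) / L (P n ^ 2)

theorem ladderS_mul (gam : K) (N : K[X] →ₗ[K] K) (n : ℕ) :
    ladderS gam L N P n * L (P n ^ 2) = gam * (recBeta L P n * N (P n * P (n - 1))) := by
  cases n with
  | zero => simp only [ladderS, recBeta, zero_mul, mul_zero]
  | succ n =>
    rw [ladderS, recBeta, Nat.add_sub_cancel]
    ring

theorem ladderS_add (hP : IsMonicOrthogonal L P) (hN : ∀ q, N (X * q) = L q) (gam : K) (n : ℕ) :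
    ladderS gam L N P (n + 1) + ladderS gam L N P n =
      gam - recAlpha P n * ladderR gam L N P n := by
  have hrec : L (P n ^ 2) = N (P (n + 1) * P n) + recAlpha P n * N (P n ^ 2) +
      recBeta L P n * N (P n * P (n - 1)) := by
    rw [← hN, sq, ← mul_assoc, hP.X_mul, add_mul, add_mul, map_add, map_add, mul_assoc, mul_assoc,
      linearMap_C_mul, linearMap_C_mul, ← sq, mul_comm (P (n - 1))]
  have hS := ladderS_mul gam N n (L := L) (P := P)
  rw [← eq_div_iff (hP.ne_zero n)] at hS
  rw [hS, ladderS, ladderR]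
  have := hP.ne_zero n
  field_simp
  linear_combination -gam * hrec

namespace IsLaguerreTriple

theorem map_derivative_X_mul (h : IsLaguerreTriple a gam t L N S) (q : K[X]) :
    L (derivative (X * q)) = (a - gam) * L q - t * (a * S q) + L (X * q) := by
  have hS := h.map_X_add_mul q
  rw [add_mul, map_add, linearMap_C_mul] at hS
  rw [h.map_derivative, h.map_X_mul]
  linear_combination a * hS

theorem map_S_sq (h : IsLaguerreTriple a gam t L N S) (hP : IsMonicOrthogonal L P) (n : ℕ) :
    a * S (P n ^ 2) = (ladderR gam L N P n - 1) * L (P n ^ 2) := by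
  have hparts := h.map_derivative (P n ^ 2)
  rw [hP.map_derivative_sq] at hparts
  have := hP.ne_zero n
  rw [ladderR]
  field_simp
  linear_combination -hparts

theorem map_S_mul_succ (h : IsLaguerreTriple a gam t L N S) (hP : IsMonicOrthogonal L P) (n : ℕ) :
    a * S (P (n + 1) * P n) = (ladderS gam L N P (n + 1) + (n + 1)) * L (P n ^ 2) := by
  have hparts := h.map_derivative (P (n + 1) * P n)
  rw [hP.map_derivative_mul_succ, hP.orthogonal (n + 1) n (by omega)] at hparts
  have := hP.ne_zero n
  rw [ladderS]
  field_simp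
  linear_combination -hparts

theorem recAlpha_eq (h : IsLaguerreTriple a gam t L N S) (hP : IsMonicOrthogonal L P) (n : ℕ) :
    recAlpha P n = 2 * n + 1 + gam - a + t * (ladderR gam L N P n - 1) := by
  have hparts := h.map_derivative_X_mul (P n ^ 2)
  rw [h.map_S_sq hP, hP.map_X_mul_sq, hP.map_derivative_X_mul_sq] at hparts
  refine mul_right_cancel₀ (hP.ne_zero n) ?_
  linear_combination -hparts

theorem recBeta_eq (h : IsLaguerreTriple a gam t L N S) (hP : IsMonicOrthogonal L P) (n : ℕ) :
    recBeta L P n = t * (ladderS gam L N P n + n) - (P n).nextCoeff := by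
  cases n with
  | zero => simp [recBeta, ladderS, hP.nextCoeff_zero]
  | succ n =>
    have hparts := h.map_derivative_X_mul (P (n + 1) * P n)
    rw [h.map_S_mul_succ hP, hP.map_X_mul_mul_succ, hP.orthogonal (n + 1) n (by omega),
      hP.map_derivative_X_mul_mul_succ] at hparts
    rw [recBeta, div_eq_iff (hP.ne_zero n)]
    push_cast
    linear_combination -hparts

theorem ladder_pole_zero (h : IsLaguerreTriple a gam t L N S) (hP : IsMonicOrthogonal L P)
    (n : ℕ) :
    ladderS gam L N P (n + 1) ^ 2 - gam * ladderS gam L N P (n + 1) =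
      recBeta L P (n + 1) * ladderR gam L N P (n + 1) * ladderR gam L N P n := by
  have hpole := hP.pole_identity (N := N) (s := 0) (by simpa using h.map_X_mul) n
  have := hP.ne_zero n
  have := hP.ne_zero (n + 1)
  simp only [ladderS, ladderR, recBeta]
  field_simp
  linear_combination gam ^ 2 * hpole

theorem ladder_pole_neg (h : IsLaguerreTriple a gam t L N S) (hP : IsMonicOrthogonal L P)
    (n : ℕ) :
    (ladderS gam L N P (n + 1) + (n + 1)) ^ 2 - a * (ladderS gam L N P (n + 1) + (n + 1)) =
      recBeta L P (n + 1) * (ladderR gam L N P (n + 1) - 1) * (ladderR gam L N P n - 1) := by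
  have hpole := hP.pole_identity (N := S) (s := t) h.map_X_add_mul n
  have hn := hP.ne_zero n
  have hn' := hP.ne_zero (n + 1)
  rw [eq_div_of_mul_eq hn (h.map_S_mul_succ hP n).symm,
    eq_div_of_mul_eq hn (h.map_S_sq hP n).symm,
    eq_div_of_mul_eq hn' (h.map_S_sq hP (n + 1)).symm, recBeta]
  field_simp
  linear_combination a ^ 2 * hpole

theorem recBeta_mul (h : IsLaguerreTriple a gam t L N S) (hP : IsMonicOrthogonal L P) (n : ℕ) :
    recBeta L P n * ladderR gam L N P n * (ladderR gam L N P n - 1) =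
      -(ladderS gam L N P n ^ 2 - gam * ladderS gam L N P n) + ladderR gam L N P n *
        ((a - gam - 2 * n) * ladderS gam L N P n + n * (a - n)) := by
  cases n with
  | zero => simp [recBeta, ladderS]
  | succ n =>
    have hzero := h.ladder_pole_zero hP n
    have hneg := h.ladder_pole_neg hP n
    push_cast
    linear_combination
      (1 - ladderR gam L N P (n + 1)) * hzero + ladderR gam L N P (n + 1) * hneg

theorem sum_ladderR (h : IsLaguerreTriple a gam t L N S) (hP : IsMonicOrthogonal L P) (n : ℕ) :
    -(t * ∑ j ∈ Finset.range n, ladderR gam L N P j) =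
      n ^ 2 + n * (gam - a - t) + (P n).nextCoeff := by
  induction n with
  | zero => simp [hP.nextCoeff_zero]
  | succ n ih =>
    have hα := h.recAlpha_eq hP n
    rw [recAlpha] at hα
    rw [Finset.sum_range_succ]
    push_cast
    linear_combination ih + hα

end IsLaguerreTriple

end Ladder

/-! ### Integration of polynomials against the kernel -/

/-- Integration of polynomials against `kernel b c t`, prescribed on monomials so that it is defined
for all parameters. -/
def polyInt (b c t : ℝ) : ℝ[X] →ₗ[ℝ] ℝ :=
  lsum fun k => kernelInt b (c + k) t • LinearMap.id

theorem polyInt_X_pow (b c t : ℝ) (k : ℕ) : polyInt b c t (X ^ k) = kernelInt b (c + k) t := by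
  rw [polyInt, lsum_apply, ← monomial_one_right_eq_X_pow, sum_monomial_index] <;>
    simp only [LinearMap.smul_apply, LinearMap.id_apply, smul_eq_mul, mul_one, mul_zero]

theorem eval_mul_kernel_eq_sum (b c t : ℝ) (q : ℝ[X]) {x : ℝ} (hx : 0 < x) :
    q.eval x * kernel b c t x =
      ∑ k ∈ Finset.range (q.natDegree + 1), q.coeff k * kernel b (c + k) t x := by
  rw [eval_eq_sum_range, Finset.sum_mul]
  refine Finset.sum_congr rfl fun k _ => ?_
  rw [kernel_add_nat b c t hx]
  ring

theorem integrableOn_eval_mul_kernel {b c t : ℝ} (h : Admissible b c t) (q : ℝ[X]) :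
    IntegrableOn (fun x => q.eval x * kernel b c t x) (Ioi 0) := by
  refine IntegrableOn.congr_fun (f := fun x =>
    ∑ k ∈ Finset.range (q.natDegree + 1), q.coeff k * kernel b (c + k) t x) ?_
    (fun x hx => (eval_mul_kernel_eq_sum b c t q hx).symm) measurableSet_Ioi
  exact integrable_finsetSum _ fun k _ => (integrableOn_kernel (h.add_nat k)).const_mul _

theorem integral_eval_mul_kernel {b c t : ℝ} (h : Admissible b c t) (q : ℝ[X]) :
    ∫ x in Ioi (0 : ℝ), q.eval x * kernel b c t x = polyInt b c t q := by
  rw [setIntegral_congr_fun measurableSet_Ioi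
      (fun x hx => eval_mul_kernel_eq_sum b c t q hx), integral_finsetSum _
      fun k _ => (integrableOn_kernel (h.add_nat k)).const_mul _,
    linearMap_eq_sum _ (Nat.lt_succ_self _)]
  refine Finset.sum_congr rfl fun k _ => ?_
  rw [integral_const_mul, polyInt_X_pow, kernelInt]

theorem polyInt_sq_pos {b c t : ℝ} (h : Admissible b c t) {q : ℝ[X]} (hq : q ≠ 0) :
    0 < polyInt b c t (q ^ 2) := by
  have hnonneg : ∀ x ∈ Ioi (0 : ℝ), 0 ≤ (q ^ 2).eval x * kernel b c t x := fun x hx => by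
    rw [eval_pow]
    exact mul_nonneg (sq_nonneg _) (kernel_pos b c h.nonneg hx).le
  rw [← integral_eval_mul_kernel h, setIntegral_pos_iff_support_of_nonneg_ae
    ((ae_restrict_iff' measurableSet_Ioi).2 (Eventually.of_forall hnonneg))
    (integrableOn_eval_mul_kernel h _)]
  have hsub : Ioi (0 : ℝ) \ (q.roots.toFinset : Set ℝ) ⊆
      Function.support (fun x => (q ^ 2).eval x * kernel b c t x) ∩ Ioi 0 := by
    rintro x ⟨hx, hroot⟩
    refine ⟨?_, hx⟩
    have hqx : q.eval x ≠ 0 := fun h0 => hroot (by simp [hq, h0])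
    rw [Function.mem_support, eval_pow]
    exact mul_ne_zero (pow_ne_zero 2 hqx) (kernel_pos b c h.nonneg hx).ne'
  refine lt_of_lt_of_le ?_ (measure_mono hsub)
  rw [measure_sdiff_null (Set.Finite.measure_zero (Finset.finite_toSet _) _)]
  simp

/-- The monic orthogonal polynomials of `kernel a gam t`. -/
def kernelOP (a gam t : ℝ) : ℕ → ℝ[X] := orthoPoly (polyInt a gam t)

theorem monic_kernelOP (a gam t : ℝ) (n : ℕ) : (kernelOP a gam t n).Monic :=
  (monic_natDegree_orthoPoly _ n).1

theorem polyInt_kernelOP_sq_pos {b c a gam t : ℝ} (h : Admissible b c t) (n : ℕ) :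
    0 < polyInt b c t (kernelOP a gam t n ^ 2) :=
  polyInt_sq_pos h (monic_kernelOP a gam t n).ne_zero

theorem isMonicOrthogonal_kernelOP {a gam t : ℝ} (h : Admissible a gam t) :
    IsMonicOrthogonal (polyInt a gam t) (kernelOP a gam t) :=
  isMonicOrthogonal_orthoPoly fun n => (polyInt_kernelOP_sq_pos h n).ne'

theorem isLaguerreTriple {a gam t : ℝ} (h : Admissible a (gam - 1) t) :
    IsLaguerreTriple a gam t (polyInt a gam t) (polyInt a (gam - 1) t)
      (polyInt (a + 1) gam t) where
  map_X_mul := by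
    refine LinearMap.congr_fun (f := polyInt a (gam - 1) t ∘ₗ LinearMap.mulLeft ℝ X)
      (linearMap_ext_X_pow fun k => ?_)
    rw [LinearMap.comp_apply, LinearMap.mulLeft_apply, ← pow_succ', polyInt_X_pow, polyInt_X_pow]
    congr 1
    push_cast
    ring
  map_X_add_mul := by
    refine LinearMap.congr_fun (f := polyInt (a + 1) gam t ∘ₗ LinearMap.mulLeft ℝ (X + C t))
      (linearMap_ext_X_pow fun k => ?_)
    rw [LinearMap.comp_apply, LinearMap.mulLeft_apply, add_mul, map_add, linearMap_C_mul,
      ← pow_succ', polyInt_X_pow, polyInt_X_pow, polyInt_X_pow,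
      ← kernelInt_shift (h.add_one_left.add_nat k)]
    push_cast
    rw [add_assoc]
  map_derivative := by
    refine LinearMap.congr_fun (f := polyInt a gam t ∘ₗ derivative)
      (g := a • polyInt (a + 1) gam t - gam • polyInt a (gam - 1) t + polyInt a gam t)
      (linearMap_ext_X_pow fun k => ?_)
    have hexp : gam + (k : ℝ) - 1 = gam - 1 + k := by ring
    have hparts := kernelInt_by_parts (b := a) (c := gam + k) (hexp ▸ h.add_nat k)
    have hmonomial :
        polyInt a gam t (derivative (X ^ k)) = k * kernelInt a (gam - 1 + k) t := by
      rw [derivative_X_pow, linearMap_C_mul, polyInt_X_pow]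
      cases k with
      | zero => simp
      | succ k => congr 2; push_cast; ring
    rw [hexp] at hparts
    simp only [LinearMap.comp_apply, LinearMap.add_apply, LinearMap.sub_apply,
      LinearMap.smul_apply, smul_eq_mul, polyInt_X_pow, hmonomial]
    linear_combination hparts

/-! ### The weight -/

section Weight

variable {lam bet gam t : ℝ}

theorem integral_eval_mul_weight (h : Admissible (lam + bet) gam t) (q : ℝ[X]) :
    ∫ x in Ioi (0 : ℝ), q.eval x * weight lam bet gam t x = polyInt (lam + bet) gam t q :=
  integral_eval_mul_kernel h q

theorem monicOP_eq_kernelOP (h : Admissible (lam + bet) gam t) (n : ℕ) :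
    monicOP lam bet gam t n = kernelOP (lam + bet) gam t n := by
  induction n using Nat.strong_induction_on with
  | _ n ih =>
    rw [monicOP, kernelOP, orthoPoly]
    congr 1
    refine Finset.sum_congr rfl fun j _ => ?_
    rw [ih j j.isLt]
    have hmul := integral_eval_mul_weight h (X ^ n * kernelOP (lam + bet) gam t j)
    have hsq := integral_eval_mul_weight h (kernelOP (lam + bet) gam t j ^ 2)
    simp only [eval_mul, eval_pow, eval_X] at hmul hsq
    rw [hmul, hsq, kernelOP]

theorem normSq_eq_polyInt (h : Admissible (lam + bet) gam t) (n : ℕ) :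
    normSq lam bet gam n t = polyInt (lam + bet) gam t (kernelOP (lam + bet) gam t n ^ 2) := by
  rw [normSq, ← integral_eval_mul_weight h, monicOP_eq_kernelOP h]
  simp only [eval_pow]

theorem Rhat_eq_ladderR (h : Admissible (lam + bet) (gam - 1) t) (n : ℕ) :
    Rhat lam bet gam n t = ladderR gam (polyInt (lam + bet) gam t)
      (polyInt (lam + bet) (gam - 1) t) (kernelOP (lam + bet) gam t) n := by
  rw [Rhat, ladderR, normSq_eq_polyInt h.of_sub_one, ← integral_eval_mul_kernel h,
    mul_div_right_comm, monicOP_eq_kernelOP h.of_sub_one]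
  congr 1
  refine setIntegral_congr_fun measurableSet_Ioi fun x hx => ?_
  simp only [eval_pow, weight, kernel]
  rw [Real.rpow_sub_one (ne_of_gt hx)]
  ring

theorem hankelDet_eq_prod (h : Admissible (lam + bet) gam t) (n : ℕ) :
    hankelDet lam bet gam n t = ∏ j ∈ Finset.range n,
      polyInt (lam + bet) gam t (kernelOP (lam + bet) gam t j ^ 2) := by
  rw [← (isMonicOrthogonal_kernelOP h).det_hankel, hankelDet]
  congr 1
  ext j k
  simp only [Matrix.of_apply, ← integral_eval_mul_weight h, eval_pow, eval_X]

theorem hankelDet_pos (h : Admissible (lam + bet) gam t) (n : ℕ) :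
    0 < hankelDet lam bet gam n t := by
  rw [hankelDet_eq_prod h]
  exact Finset.prod_pos fun j _ => polyInt_kernelOP_sq_pos h j

end Weight

/-! ### Regularity and derivatives in the parameter -/

/-- A class of functions, such as those regular at `t₀`, that is closed under the field
operations, division being restricted to denominators not vanishing at `t₀`. -/
structure IsFieldClosed {α K : Type*} [Field K] (t₀ : α) (Φ : (α → K) → Prop) : Prop where
  const : ∀ c, Φ fun _ => c
  add : ∀ f g, Φ f → Φ g → Φ fun t => f t + g t
  mul : ∀ f g, Φ f → Φ g → Φ fun t => f t * g t
  div : ∀ f g, Φ f → Φ g → g t₀ ≠ 0 → Φ fun t => f t / g t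

namespace IsFieldClosed

theorem continuousWithinAt (s : Set ℝ) (t₀ : ℝ) :
    IsFieldClosed t₀ fun f : ℝ → ℝ => ContinuousWithinAt f s t₀ where
  const _ := continuousWithinAt_const
  add _ _ hf hg := hf.add hg
  mul _ _ hf hg := hf.mul hg
  div _ _ hf hg h := hf.div hg h

theorem differentiableWithinAt (s : Set ℝ) (t₀ : ℝ) :
    IsFieldClosed t₀ fun f : ℝ → ℝ => DifferentiableWithinAt ℝ f s t₀ where
  const _ := differentiableWithinAt_const _
  add _ _ hf hg := hf.add hg
  mul _ _ hf hg := hf.mul hg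
  div _ _ hf hg h := hf.div hg h

theorem contDiffAt (m : WithTop ℕ∞) (t₀ : ℝ) :
    IsFieldClosed t₀ fun f : ℝ → ℝ => ContDiffAt ℝ m f t₀ where
  const _ := contDiffAt_const
  add _ _ hf hg := hf.add hg
  mul _ _ hf hg := hf.mul hg
  div _ _ hf hg h := hf.div hg h

variable {α K : Type*} [Field K] {t₀ : α} {Φ : (α → K) → Prop}

theorem sum (hΦ : IsFieldClosed t₀ Φ) {ι : Type*} (s : Finset ι) (f : ι → α → K)
    (h : ∀ i ∈ s, Φ (f i)) : Φ fun t => ∑ i ∈ s, f i t := by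
  classical
  induction s using Finset.induction_on with
  | empty => simpa using hΦ.const 0
  | insert i s hi ih =>
    simp only [Finset.sum_insert hi]
    exact hΦ.add _ _ (h i (Finset.mem_insert_self i s))
      (ih fun j hj => h j (Finset.mem_insert_of_mem hj))

theorem linearMap_mul (hΦ : IsFieldClosed t₀ Φ) {L : α → K[X] →ₗ[K] K}
    (hL : ∀ k : ℕ, Φ fun t => L t (X ^ k)) {p q : α → K[X]} (hp : ∀ k, Φ fun t => (p t).coeff k)
    (hq : ∀ k, Φ fun t => (q t).coeff k) {m n : ℕ} (hm : ∀ t, (p t).natDegree ≤ m)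
    (hn : ∀ t, (q t).natDegree ≤ n) : Φ fun t => L t (p t * q t) := by
  have hdeg : ∀ t, (p t * q t).natDegree < m + n + 1 := fun t =>
    Nat.lt_succ_of_le (natDegree_mul_le.trans (add_le_add (hm t) (hn t)))
  simp only [fun t => linearMap_eq_sum (L t) (hdeg t), coeff_mul]
  exact hΦ.sum _ _ fun k _ => hΦ.mul _ _ (hΦ.sum _ _ fun i _ => hΦ.mul _ _ (hp i.1) (hq i.2)) (hL k)

section OrthoPoly

variable {L N : α → K[X] →ₗ[K] K}

theorem coeff_orthoPoly (hΦ : IsFieldClosed t₀ Φ) (hL : ∀ k : ℕ, Φ fun t => L t (X ^ k))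
    (h₀ : ∀ n, L t₀ (orthoPoly (L t₀) n ^ 2) ≠ 0) (n : ℕ) :
    ∀ k, Φ fun t => (orthoPoly (L t) n).coeff k := by
  induction n using Nat.strong_induction_on with
  | _ n ih =>
    intro k
    have hdeg : ∀ j t, (orthoPoly (L t) j).natDegree ≤ j := fun j t =>
      (monic_natDegree_orthoPoly (L t) j).2.le
    have hexpand : (fun t => (orthoPoly (L t) n).coeff k) = fun t => (X ^ n : K[X]).coeff k +
        ∑ j : Fin n, (-1) * ((L t (X ^ n * orthoPoly (L t) j) / L t (orthoPoly (L t) j ^ 2)) *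
          (orthoPoly (L t) j).coeff k) := by
      funext t
      conv_lhs => rw [orthoPoly]
      rw [coeff_sub, finsetSum_coeff, ← Finset.mul_sum]
      simp only [coeff_C_mul]
      ring
    rw [hexpand]
    refine hΦ.add _ _ (hΦ.const _) (hΦ.sum _ _ fun j _ => hΦ.mul _ _ (hΦ.const _)
      (hΦ.mul _ _ (hΦ.div _ _ ?_ ?_ (h₀ j)) (ih j j.isLt k)))
    · exact hΦ.linearMap_mul hL (fun i => hΦ.const _) (ih j j.isLt)
        (fun t => (natDegree_X_pow n).le) (hdeg j)
    · simp only [sq]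
      exact hΦ.linearMap_mul hL (ih j j.isLt) (ih j j.isLt) (hdeg j) (hdeg j)

theorem nextCoeff_orthoPoly (hΦ : IsFieldClosed t₀ Φ) (hL : ∀ k : ℕ, Φ fun t => L t (X ^ k))
    (h₀ : ∀ n, L t₀ (orthoPoly (L t₀) n ^ 2) ≠ 0) (n : ℕ) :
    Φ fun t => (orthoPoly (L t) n).nextCoeff := by
  simp only [nextCoeff, (monic_natDegree_orthoPoly _ n).2]
  cases n with
  | zero => exact hΦ.const 0
  | succ n => exact hΦ.coeff_orthoPoly hL h₀ (n + 1) n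

theorem linearMap_orthoPoly_mul (hΦ : IsFieldClosed t₀ Φ) (hL : ∀ k : ℕ, Φ fun t => L t (X ^ k))
    (hN : ∀ k : ℕ, Φ fun t => N t (X ^ k)) (h₀ : ∀ n, L t₀ (orthoPoly (L t₀) n ^ 2) ≠ 0)
    (m n : ℕ) : Φ fun t => N t (orthoPoly (L t) m * orthoPoly (L t) n) :=
  hΦ.linearMap_mul hN (hΦ.coeff_orthoPoly hL h₀ m) (hΦ.coeff_orthoPoly hL h₀ n)
    (fun t => (monic_natDegree_orthoPoly (L t) m).2.le)
    (fun t => (monic_natDegree_orthoPoly (L t) n).2.le)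

theorem ladderR (hΦ : IsFieldClosed t₀ Φ) (gam : K) (hL : ∀ k : ℕ, Φ fun t => L t (X ^ k))
    (hN : ∀ k : ℕ, Φ fun t => N t (X ^ k)) (h₀ : ∀ n, L t₀ (orthoPoly (L t₀) n ^ 2) ≠ 0) (n : ℕ) :
    Φ fun t => ladderR gam (L t) (N t) (orthoPoly (L t)) n := by
  have hnum := hΦ.linearMap_orthoPoly_mul hL hN h₀ n n
  have hden := hΦ.linearMap_orthoPoly_mul hL hL h₀ n n
  simp only [← sq] at hnum hden
  exact hΦ.div _ _ (hΦ.mul _ _ (hΦ.const gam) hnum) hden (h₀ n)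

theorem ladderS (hΦ : IsFieldClosed t₀ Φ) (gam : K) (hL : ∀ k : ℕ, Φ fun t => L t (X ^ k))
    (hN : ∀ k : ℕ, Φ fun t => N t (X ^ k)) (h₀ : ∀ n, L t₀ (orthoPoly (L t₀) n ^ 2) ≠ 0) (n : ℕ) :
    Φ fun t => ladderS gam (L t) (N t) (orthoPoly (L t)) n := by
  cases n with
  | zero => exact hΦ.const 0
  | succ n =>
    have hden := hΦ.linearMap_orthoPoly_mul hL hL h₀ n n
    simp only [← sq] at hden
    exact hΦ.div _ _ (hΦ.mul _ _ (hΦ.const gam)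
      (hΦ.linearMap_orthoPoly_mul hL hN h₀ (n + 1) n)) hden (h₀ n)

end OrthoPoly

end IsFieldClosed

section Parameter

variable {b c t : ℝ}

theorem contDiffAt_polyInt_X_pow (b : ℝ) (ht : 0 < t) (hc : -1 < c) (m k : ℕ) :
    ContDiffAt ℝ m (fun s => polyInt b c s (X ^ k)) t := by
  simp only [polyInt_X_pow]
  have : (0 : ℝ) ≤ k := k.cast_nonneg
  exact (contDiffOn_kernelInt (by linarith) m b).contDiffAt (Ioi_mem_nhds ht)

theorem continuousWithinAt_polyInt_X_pow_zero (hc : -1 < c) (hcb : -1 < c - b) (k : ℕ) :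
    ContinuousWithinAt (fun s => polyInt b c s (X ^ k)) (Ici 0) 0 := by
  simp only [polyInt_X_pow]
  have : (0 : ℝ) ≤ k := k.cast_nonneg
  exact continuousWithinAt_kernelInt_zero (by linarith) (by linarith)

theorem differentiableWithinAt_polyInt_X_pow_zero (hc : -1 < c) (hcb : 0 < c - b) (k : ℕ) :
    DifferentiableWithinAt ℝ (fun s => polyInt b c s (X ^ k)) (Ici 0) 0 := by
  simp only [polyInt_X_pow]
  have : (0 : ℝ) ≤ k := k.cast_nonneg
  exact differentiableWithinAt_kernelInt_zero (by linarith) (by linarith)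

theorem hasDerivAt_polyInt (b : ℝ) (ht : 0 < t) (hc : -1 < c) (q : ℝ[X]) :
    HasDerivAt (fun s => polyInt b c s q) (-polyInt b c t q - b * polyInt (b + 1) c t q) t := by
  have hmonomial : ∀ k : ℕ, HasDerivAt (fun s => q.coeff k * polyInt b c s (X ^ k))
      (-(q.coeff k * polyInt b c t (X ^ k)) - b * (q.coeff k * polyInt (b + 1) c t (X ^ k))) t := by
    intro k
    simp only [polyInt_X_pow]
    have : (0 : ℝ) ≤ k := k.cast_nonneg
    exact ((hasDerivAt_kernelInt b ht (by linarith)).const_mul _).congr_deriv (by ring)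
  simp only [fun b s => linearMap_eq_sum (polyInt b c s) (Nat.lt_succ_self q.natDegree)]
  refine (HasDerivAt.fun_sum fun k _ => hmonomial k).congr_deriv ?_
  rw [Finset.sum_sub_distrib, Finset.sum_neg_distrib, Finset.mul_sum]

theorem hasDerivAt_polyInt_mul (b : ℝ) (ht : 0 < t) (hc : -1 < c) {p : ℝ → ℝ[X]} {p' : ℝ[X]} {N : ℕ}
    (hN : ∀ s, (p s).natDegree ≤ N)
    (hp : ∀ k, HasDerivAt (fun s => (p s).coeff k) (p'.coeff k) t) (q : ℝ[X]) :
    HasDerivAt (fun s => polyInt b c s (p s * q))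
      (polyInt b c t (p' * q) - polyInt b c t (p t * q) - b * polyInt (b + 1) c t (p t * q)) t := by
  have hN' : p'.natDegree ≤ N := by
    refine natDegree_le_iff_coeff_eq_zero.2 fun k hk => (hp k).unique ?_
    simp only [fun s => coeff_eq_zero_of_natDegree_lt ((hN s).trans_lt hk)]
    exact hasDerivAt_const t 0
  have hexpand : ∀ (b' s : ℝ) {r : ℝ[X]}, r.natDegree ≤ N → polyInt b' c s (r * q) =
      ∑ k ∈ Finset.range (N + 1), r.coeff k * polyInt b' c s (X ^ k * q) := fun b' s r hr =>
    linearMap_eq_sum (polyInt b' c s ∘ₗ LinearMap.mulRight ℝ q) (Nat.lt_succ_of_le hr)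
  simp only [fun s => hexpand b s (hN s), hexpand b t hN', hexpand (b + 1) t (hN t)]
  refine (HasDerivAt.fun_sum fun k _ =>
    (hp k).mul (hasDerivAt_polyInt b ht hc (X ^ k * q))).congr_deriv ?_
  rw [Finset.mul_sum, ← Finset.sum_sub_distrib, ← Finset.sum_sub_distrib]
  exact Finset.sum_congr rfl fun k _ => by ring

end Parameter

/-- The `t`-derivative of `kernelOP a gam t n`; the coefficients of degree at least `n` do not
depend on `t`. -/
def kernelOPDeriv (a gam t : ℝ) (n : ℕ) : ℝ[X] :=
  ofFn n fun k => deriv (fun s => (kernelOP a gam s n).coeff k) t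

/-- The squared norm of the `n`-th monic orthogonal polynomial of `kernel a gam t`. -/
def kernelNorm (a gam : ℝ) (n : ℕ) (t : ℝ) : ℝ := polyInt a gam t (kernelOP a gam t n ^ 2)

/-- The subleading coefficient of the `n`-th monic orthogonal polynomial of `kernel a gam t`. -/
def kernelNext (a gam : ℝ) (n : ℕ) (t : ℝ) : ℝ := (kernelOP a gam t n).nextCoeff

/-- The recurrence coefficient `recBeta` of `kernel a gam t`, as a function of `t`. -/
def kernelBeta (a gam : ℝ) (n : ℕ) (t : ℝ) : ℝ := recBeta (polyInt a gam t) (kernelOP a gam t) n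

/-- The ladder quantity `ladderR` of `kernel a gam t`, as a function of `t`. -/
def kernelR (a gam : ℝ) (n : ℕ) (t : ℝ) : ℝ :=
  ladderR gam (polyInt a gam t) (polyInt a (gam - 1) t) (kernelOP a gam t) n

/-- The ladder quantity `ladderS` of `kernel a gam t`, as a function of `t`. -/
def kernelS (a gam : ℝ) (n : ℕ) (t : ℝ) : ℝ :=
  ladderS gam (polyInt a gam t) (polyInt a (gam - 1) t) (kernelOP a gam t) n

/-- The right-hand side of the Riccati equation `t R' = driftR` for `R = kernelR a gam n`. -/
def driftR (a gam : ℝ) (n : ℕ) (t : ℝ) : ℝ :=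
  2 * kernelS a gam n t - gam +
    (2 * n + gam - a - t + t * kernelR a gam n t) * kernelR a gam n t

/-- The common right-hand side of `t S' = driftS` for `S = kernelS a gam n` and of `β' = driftS`
for `β = kernelBeta a gam n`. -/
def driftS (a gam : ℝ) (n : ℕ) (t : ℝ) : ℝ :=
  (kernelS a gam n t ^ 2 - gam * kernelS a gam n t -
    kernelBeta a gam n t * kernelR a gam n t ^ 2) / kernelR a gam n t

theorem kernelNorm_pos {a gam t : ℝ} (h : Admissible a gam t) (n : ℕ) : 0 < kernelNorm a gam n t :=
  polyInt_kernelOP_sq_pos h n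

section Ladder

variable {a gam t : ℝ}

theorem kernelR_pos (h : Admissible a (gam - 1) t) (hgam : 0 < gam) (n : ℕ) :
    0 < kernelR a gam n t :=
  div_pos (mul_pos hgam (polyInt_kernelOP_sq_pos h n)) (kernelNorm_pos h.of_sub_one n)

theorem kernelR_ne_one (h : Admissible a (gam - 1) t) (ha : a ≠ 0) (n : ℕ) :
    kernelR a gam n t ≠ 1 := by
  intro hR
  have hS := (isLaguerreTriple h).map_S_sq (isMonicOrthogonal_kernelOP h.of_sub_one) n
  rw [kernelR] at hR
  rw [hR, sub_self, zero_mul] at hS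
  exact mul_ne_zero ha (polyInt_kernelOP_sq_pos h.add_one_left n).ne' hS

theorem kernelNext_sub_kernelNext (h : Admissible a (gam - 1) t) (n : ℕ) :
    kernelNext a gam n t - kernelNext a gam (n + 1) t =
      2 * n + 1 + gam - a + t * (kernelR a gam n t - 1) :=
  (isLaguerreTriple h).recAlpha_eq (isMonicOrthogonal_kernelOP h.of_sub_one) n

theorem kernelS_succ_add_kernelS (h : Admissible a (gam - 1) t) (n : ℕ) :
    kernelS a gam (n + 1) t + kernelS a gam n t =
      gam - (2 * n + 1 + gam - a + t * (kernelR a gam n t - 1)) * kernelR a gam n t := by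
  rw [← kernelNext_sub_kernelNext h]
  exact ladderS_add (isMonicOrthogonal_kernelOP h.of_sub_one) (isLaguerreTriple h).map_X_mul gam n

theorem kernelBeta_eq (h : Admissible a (gam - 1) t) (n : ℕ) :
    kernelBeta a gam n t = t * (kernelS a gam n t + n) - kernelNext a gam n t :=
  (isLaguerreTriple h).recBeta_eq (isMonicOrthogonal_kernelOP h.of_sub_one) n

theorem kernelBeta_mul (h : Admissible a (gam - 1) t) (n : ℕ) :
    kernelBeta a gam n t * kernelR a gam n t * (kernelR a gam n t - 1) =
      -(kernelS a gam n t ^ 2 - gam * kernelS a gam n t) + kernelR a gam n t *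
        ((a - gam - 2 * n) * kernelS a gam n t + n * (a - n)) :=
  (isLaguerreTriple h).recBeta_mul (isMonicOrthogonal_kernelOP h.of_sub_one) n

theorem kernelS_sq_sub (h : Admissible a (gam - 1) t) (n : ℕ) :
    kernelS a gam (n + 1) t ^ 2 - gam * kernelS a gam (n + 1) t =
      kernelBeta a gam (n + 1) t * kernelR a gam (n + 1) t * kernelR a gam n t :=
  (isLaguerreTriple h).ladder_pole_zero (isMonicOrthogonal_kernelOP h.of_sub_one) n

theorem neg_mul_sum_kernelR (h : Admissible a (gam - 1) t) (n : ℕ) :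
    -(t * ∑ j ∈ Finset.range n, kernelR a gam j t) =
      n ^ 2 + n * (gam - a - t) + kernelNext a gam n t :=
  (isLaguerreTriple h).sum_ladderR (isMonicOrthogonal_kernelOP h.of_sub_one) n

end Ladder

/-! ### The first-order system in `t` -/

section Evolution

variable {a gam t : ℝ}

theorem hasDerivAt_coeff_kernelOP (ht : 0 < t) (hgam : -1 < gam) (n k : ℕ) :
    HasDerivAt (fun s => (kernelOP a gam s n).coeff k) ((kernelOPDeriv a gam t n).coeff k) t := by
  rcases lt_or_ge k n with hk | hk
  · rw [kernelOPDeriv, ofFn_coeff_eq_val_of_lt _ hk]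
    have hreg := (IsFieldClosed.contDiffAt (1 : ℕ) t).coeff_orthoPoly
      (contDiffAt_polyInt_X_pow a ht hgam 1)
      (isMonicOrthogonal_kernelOP (Or.inl ⟨ht, hgam⟩)).ne_zero n k
    exact (hreg.differentiableAt (by simp)).hasDerivAt
  · rw [kernelOPDeriv, ofFn_coeff_eq_zero_of_ge _ hk]
    have hconst : (fun s => (kernelOP a gam s n).coeff k) = fun _ => if k = n then 1 else 0 := by
      funext s
      obtain ⟨hmonic, hdeg⟩ := monic_natDegree_orthoPoly (polyInt a gam s) n
      split_ifs with hkn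
      · rw [hkn]
        simpa only [kernelOP, hdeg] using hmonic.coeff_natDegree
      · exact coeff_eq_zero_of_natDegree_lt (hdeg.trans_lt (lt_of_le_of_ne hk (Ne.symm hkn)))
    rw [hconst]
    exact hasDerivAt_const t _

theorem hasDerivAt_polyInt_kernelOP_mul (ht : 0 < t) (hgam : -1 < gam) (n : ℕ) (q : ℝ[X]) :
    HasDerivAt (fun s => polyInt a gam s (kernelOP a gam s n * q))
      (polyInt a gam t (kernelOPDeriv a gam t n * q) - polyInt a gam t (kernelOP a gam t n * q) -
        a * polyInt (a + 1) gam t (kernelOP a gam t n * q)) t :=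
  hasDerivAt_polyInt_mul a ht hgam (fun _ => (monic_natDegree_orthoPoly _ n).2.le)
    (hasDerivAt_coeff_kernelOP ht hgam n) q

theorem hasDerivAt_kernelNorm (ht : 0 < t) (hgam : 0 < gam) (n : ℕ) :
    HasDerivAt (kernelNorm a gam n) (-(kernelR a gam n t * kernelNorm a gam n t)) t := by
  have hgam' : -1 < gam := by linarith
  have h : Admissible a (gam - 1) t := Or.inl ⟨ht, by linarith⟩
  have hP := isMonicOrthogonal_kernelOP h.of_sub_one
  have hnorm : ∀ s, 0 < s →
      kernelNorm a gam n s = polyInt a gam s (kernelOP a gam s n * kernelOP a gam t n) := by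
    intro s hs
    rw [(isMonicOrthogonal_kernelOP (Or.inl ⟨hs, hgam'⟩)).map_mul_of_natDegree_le
      (hP.natDegree_eq n).le, hP.coeff_self, one_mul, kernelNorm]
  have horth : polyInt a gam t (kernelOPDeriv a gam t n * kernelOP a gam t n) = 0 := by
    rw [mul_comm]
    exact hP.map_mul_of_degree_lt (ofFn_degree_lt _)
  have hS : a * polyInt (a + 1) gam t (kernelOP a gam t n ^ 2) =
      (kernelR a gam n t - 1) * kernelNorm a gam n t := (isLaguerreTriple h).map_S_sq hP n
  refine ((hasDerivAt_polyInt_kernelOP_mul (a := a) ht hgam' n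
    (kernelOP a gam t n)).congr_of_eventuallyEq ?_).congr_deriv ?_
  · filter_upwards [Ioi_mem_nhds ht] with s hs using hnorm s hs
  · rw [horth, ← hnorm t ht, ← sq, hS]
    ring

theorem kernelNext_succ (a gam : ℝ) (n : ℕ) :
    kernelNext a gam (n + 1) = fun s => (kernelOP a gam s (n + 1)).coeff n := by
  funext s
  have hdeg := (monic_natDegree_orthoPoly (polyInt a gam s) (n + 1)).2
  rw [kernelNext, nextCoeff_of_natDegree_pos (by rw [kernelOP, hdeg]; omega), kernelOP, hdeg,
    Nat.add_sub_cancel]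

theorem hasDerivAt_kernelNext (ht : 0 < t) (hgam : 0 < gam) (n : ℕ) :
    HasDerivAt (kernelNext a gam n) (kernelS a gam n t + n) t := by
  have hgam' : -1 < gam := by linarith
  have h : Admissible a (gam - 1) t := Or.inl ⟨ht, by linarith⟩
  have hP := isMonicOrthogonal_kernelOP h.of_sub_one
  cases n with
  | zero =>
    have hzero : kernelNext a gam 0 = fun _ => 0 := funext fun s => by
      rw [kernelNext, nextCoeff, kernelOP, (monic_natDegree_orthoPoly _ 0).2, if_pos rfl]
    simpa [hzero, kernelS, ladderS] using hasDerivAt_const t (0 : ℝ)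
  | succ n =>
    have horth : HasDerivAt
        (fun s => polyInt a gam s (kernelOP a gam s (n + 1) * kernelOP a gam t n)) 0 t := by
      refine (hasDerivAt_const t (0 : ℝ)).congr_of_eventuallyEq ?_
      filter_upwards [Ioi_mem_nhds ht] with s hs
      exact (isMonicOrthogonal_kernelOP (Or.inl ⟨hs, hgam'⟩)).map_mul_of_natDegree_lt
        (by rw [hP.natDegree_eq]; omega)
    have hbalance := (hasDerivAt_polyInt_kernelOP_mul ht hgam' (n + 1) (kernelOP a gam t n)).unique
      horth
    have hdeg : (kernelOPDeriv a gam t (n + 1)).natDegree ≤ n :=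
      natDegree_le_of_degree_le (Order.le_of_lt_succ (by exact_mod_cast ofFn_degree_lt _))
    rw [mul_comm, hP.map_mul_of_natDegree_le hdeg, hP.orthogonal (n + 1) n (by omega),
      (isLaguerreTriple h).map_S_mul_succ hP] at hbalance
    rw [kernelNext_succ]
    refine (hasDerivAt_coeff_kernelOP ht hgam' (n + 1) n).congr_deriv ?_
    refine mul_right_cancel₀ (hP.ne_zero n) ?_
    rw [kernelS]
    push_cast
    linear_combination hbalance

theorem hasDerivAt_kernelR (ht : 0 < t) (hgam : 0 < gam) (n : ℕ) :
    HasDerivAt (kernelR a gam n) (driftR a gam n t / t) t := by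
  have h : ∀ s, 0 < s → Admissible a (gam - 1) s := fun s hs => Or.inl ⟨hs, by linarith⟩
  have hR : ∀ s, 0 < s → kernelR a gam n s = (kernelNext a gam n s - kernelNext a gam (n + 1) s -
      (2 * n + 1 + gam - a)) / s + 1 := fun s hs => by
    rw [kernelNext_sub_kernelNext (h s hs)]
    field_simp
    ring
  have hderiv := ((((hasDerivAt_kernelNext (a := a) ht hgam n).sub
    (hasDerivAt_kernelNext (a := a) ht hgam (n + 1))).sub_const
      (2 * (n : ℝ) + 1 + gam - a)).div (hasDerivAt_id t) ht.ne').add_const 1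
  refine (hderiv.congr_of_eventuallyEq
    (eventually_of_mem (Ioi_mem_nhds ht) hR)).congr_deriv ?_
  simp only [Pi.sub_apply, id]
  rw [kernelNext_sub_kernelNext (h t ht), eq_sub_of_add_eq (kernelS_succ_add_kernelS (h t ht) n),
    driftR]
  push_cast
  field_simp
  ring

theorem hasDerivAt_kernelBeta (ht : 0 < t) (hgam : 0 < gam) (n : ℕ) :
    HasDerivAt (kernelBeta a gam n) (driftS a gam n t) t := by
  have h : Admissible a (gam - 1) t := Or.inl ⟨ht, by linarith⟩
  cases n with
  | zero =>
    refine (hasDerivAt_const t (0 : ℝ)).congr_deriv ?_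
    simp [driftS, kernelS, ladderS, kernelBeta, recBeta]
  | succ n =>
    have hn := (kernelNorm_pos h.of_sub_one n).ne'
    have hR := (kernelR_pos h hgam (n + 1)).ne'
    have hβ : kernelBeta a gam (n + 1) t = kernelNorm a gam (n + 1) t / kernelNorm a gam n t := rfl
    refine ((hasDerivAt_kernelNorm (a := a) ht hgam (n + 1)).div
      (hasDerivAt_kernelNorm ht hgam n) hn).congr_deriv ?_
    rw [driftS, kernelS_sq_sub h, hβ]
    field_simp
    ring

theorem hasDerivAt_kernelS (ht : 0 < t) (hgam : 0 < gam) (n : ℕ) :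
    HasDerivAt (kernelS a gam n) (driftS a gam n t / t) t := by
  have h : ∀ s, 0 < s → Admissible a (gam - 1) s := fun s hs => Or.inl ⟨hs, by linarith⟩
  have hS : ∀ s, 0 < s →
      kernelS a gam n s = (kernelBeta a gam n s + kernelNext a gam n s) / s - n := fun s hs => by
    rw [kernelBeta_eq (h s hs)]
    field_simp
    ring
  have hderiv := (((hasDerivAt_kernelBeta (a := a) ht hgam n).add
    (hasDerivAt_kernelNext (a := a) ht hgam n)).div (hasDerivAt_id t) ht.ne').sub_const (n : ℝ)
  refine (hderiv.congr_of_eventuallyEq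
    (eventually_of_mem (Ioi_mem_nhds ht) hS)).congr_deriv ?_
  simp only [Pi.add_apply, id]
  rw [kernelBeta_eq (h t ht)]
  field_simp
  ring

end Evolution

/-! ### The behaviour at `t = 0` -/

section AtZero

variable {a gam : ℝ}

theorem polyInt_zero_derivative_X_mul (h : -1 < gam - a) (q : ℝ[X]) :
    polyInt a gam 0 (derivative (X * q)) =
      (a - gam) * polyInt a gam 0 q + polyInt a gam 0 (X * q) := by
  refine LinearMap.congr_fun (f := polyInt a gam 0 ∘ₗ derivative ∘ₗ LinearMap.mulLeft ℝ X)
    (g := (a - gam) • polyInt a gam 0 + polyInt a gam 0 ∘ₗ LinearMap.mulLeft ℝ X)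
    (linearMap_ext_X_pow fun k => ?_) q
  have : (0 : ℝ) ≤ k := k.cast_nonneg
  have hrec := kernelInt_zero_add_one (b := a) (c := gam + k) (by linarith)
  simp only [LinearMap.comp_apply, LinearMap.add_apply, LinearMap.smul_apply, smul_eq_mul,
    LinearMap.mulLeft_apply]
  rw [← pow_succ', derivative_X_pow, linearMap_C_mul, Nat.add_sub_cancel, polyInt_X_pow,
    polyInt_X_pow]
  push_cast
  rw [← add_assoc, hrec]
  ring

theorem kernelNext_zero (h : -1 < gam - a) (n : ℕ) :
    kernelNext a gam n 0 = -(n ^ 2 + n * (gam - a)) := by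
  have hP := isMonicOrthogonal_kernelOP (a := a) (gam := gam) (t := 0) (Or.inr ⟨rfl, h⟩)
  induction n with
  | zero => simp [kernelNext, hP.nextCoeff_zero]
  | succ n ih =>
    have hparts := polyInt_zero_derivative_X_mul h (kernelOP a gam 0 n ^ 2)
    rw [hP.map_derivative_X_mul_sq, hP.map_X_mul_sq, ← add_mul] at hparts
    have hα := mul_right_cancel₀ (hP.ne_zero n) hparts
    rw [recAlpha] at hα
    rw [kernelNext] at ih ⊢
    push_cast
    linear_combination ih + hα

theorem kernelBeta_zero (h : 0 < gam - a) (n : ℕ) :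
    kernelBeta a gam n 0 = n ^ 2 + n * (gam - a) := by
  rw [kernelBeta_eq (Or.inr ⟨rfl, by linarith⟩), kernelNext_zero (by linarith)]
  ring

theorem polyInt_add_one_zero (h : 0 < gam - a) :
    polyInt (a + 1) gam 0 = polyInt a (gam - 1) 0 := by
  refine linearMap_ext_X_pow fun k => ?_
  have : (0 : ℝ) ≤ k := k.cast_nonneg
  rw [polyInt_X_pow, polyInt_X_pow, kernelInt_zero (by linarith), kernelInt_zero (by linarith)]
  congr 1
  ring

theorem kernelR_zero (h : 0 < gam - a) (n : ℕ) : kernelR a gam n 0 = gam / (gam - a) := by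
  have hadm : Admissible a (gam - 1) 0 := Or.inr ⟨rfl, by linarith⟩
  have hP := isMonicOrthogonal_kernelOP hadm.of_sub_one
  have hS := (isLaguerreTriple hadm).map_S_sq hP n
  have := hP.ne_zero n
  rw [polyInt_add_one_zero h, ladderR] at hS
  rw [kernelR, ladderR]
  field_simp at hS ⊢
  linear_combination -gam * hS

theorem kernelS_zero (h : 0 < gam - a) (n : ℕ) : kernelS a gam n 0 = -(n * gam / (gam - a)) := by
  cases n with
  | zero => simp [kernelS, ladderS]
  | succ n =>
    have hadm : Admissible a (gam - 1) 0 := Or.inr ⟨rfl, by linarith⟩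
    have hP := isMonicOrthogonal_kernelOP hadm.of_sub_one
    have hS := (isLaguerreTriple hadm).map_S_mul_succ hP n
    have := hP.ne_zero n
    rw [polyInt_add_one_zero h, ladderS] at hS
    rw [kernelS, ladderS]
    push_cast
    field_simp at hS ⊢
    linear_combination -gam * hS

theorem continuousWithinAt_kernelNext_zero (hgam : -1 < gam) (h : -1 < gam - a) (n : ℕ) :
    ContinuousWithinAt (kernelNext a gam n) (Ici 0) 0 :=
  (IsFieldClosed.continuousWithinAt (Ici 0) 0).nextCoeff_orthoPoly
    (continuousWithinAt_polyInt_X_pow_zero hgam h)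
    (isMonicOrthogonal_kernelOP (Or.inr ⟨rfl, h⟩)).ne_zero n

theorem continuousWithinAt_kernelR_zero (hgam : 0 < gam) (h : 0 < gam - a) (n : ℕ) :
    ContinuousWithinAt (kernelR a gam n) (Ici 0) 0 :=
  (IsFieldClosed.continuousWithinAt (Ici 0) 0).ladderR gam
    (continuousWithinAt_polyInt_X_pow_zero (by linarith) (by linarith))
    (continuousWithinAt_polyInt_X_pow_zero (by linarith) (by linarith))
    (isMonicOrthogonal_kernelOP (Or.inr ⟨rfl, by linarith⟩)).ne_zero n

theorem continuousWithinAt_kernelS_zero (hgam : 0 < gam) (h : 0 < gam - a) (n : ℕ) :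
    ContinuousWithinAt (kernelS a gam n) (Ici 0) 0 :=
  (IsFieldClosed.continuousWithinAt (Ici 0) 0).ladderS gam
    (continuousWithinAt_polyInt_X_pow_zero (by linarith) (by linarith))
    (continuousWithinAt_polyInt_X_pow_zero (by linarith) (by linarith))
    (isMonicOrthogonal_kernelOP (Or.inr ⟨rfl, by linarith⟩)).ne_zero n

theorem differentiableWithinAt_kernelR_zero (hgam : 0 < gam) (h : 1 < gam - a) (n : ℕ) :
    DifferentiableWithinAt ℝ (kernelR a gam n) (Ici 0) 0 :=
  (IsFieldClosed.differentiableWithinAt (Ici 0) 0).ladderR gam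
    (differentiableWithinAt_polyInt_X_pow_zero (by linarith) (by linarith))
    (differentiableWithinAt_polyInt_X_pow_zero (by linarith) (by linarith))
    (isMonicOrthogonal_kernelOP (Or.inr ⟨rfl, by linarith⟩)).ne_zero n

theorem differentiableWithinAt_kernelS_zero (hgam : 0 < gam) (h : 1 < gam - a) (n : ℕ) :
    DifferentiableWithinAt ℝ (kernelS a gam n) (Ici 0) 0 :=
  (IsFieldClosed.differentiableWithinAt (Ici 0) 0).ladderS gam
    (differentiableWithinAt_polyInt_X_pow_zero (by linarith) (by linarith))
    (differentiableWithinAt_polyInt_X_pow_zero (by linarith) (by linarith))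
    (isMonicOrthogonal_kernelOP (Or.inr ⟨rfl, by linarith⟩)).ne_zero n

theorem driftR_zero (h : 0 < gam - a) (n : ℕ) : driftR a gam n 0 = 0 := by
  rw [driftR, kernelR_zero h, kernelS_zero h]
  field_simp
  ring

theorem driftS_zero (h : 0 < gam - a) (n : ℕ) : driftS a gam n 0 = 0 := by
  rw [driftS, kernelR_zero h, kernelS_zero h, kernelBeta_zero h, div_eq_zero_iff]
  left
  field_simp
  ring

theorem hasDerivWithinAt_kernelBeta_zero (hgam : 0 < gam) (h : 0 < gam - a) (n : ℕ) :
    HasDerivWithinAt (kernelBeta a gam n) 0 (Ici 0) 0 := by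
  have hR := continuousWithinAt_kernelR_zero hgam h n
  have hS := continuousWithinAt_kernelS_zero hgam h n
  have hadm : ∀ t ∈ Ici (0 : ℝ), Admissible a (gam - 1) t := fun t ht =>
    (eq_or_lt_of_le ht).symm.imp (⟨·, by linarith⟩) (⟨·.symm, by linarith⟩)
  have hβ : ContinuousWithinAt (kernelBeta a gam n) (Ici 0) 0 :=
    ((continuousWithinAt_id.mul (hS.add continuousWithinAt_const)).sub
      (continuousWithinAt_kernelNext_zero (by linarith) (by linarith) n)).congr
      (fun t ht => kernelBeta_eq (hadm t ht) n) (kernelBeta_eq (hadm 0 self_mem_Ici) n)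
  have hR0 : kernelR a gam n 0 ≠ 0 := by
    rw [kernelR_zero h]
    exact (div_pos hgam h).ne'
  have hdrift : ContinuousWithinAt (driftS a gam n) (Ici 0) 0 :=
    (((hS.pow 2).sub (continuousWithinAt_const.mul hS)).sub (hβ.mul (hR.pow 2))).div hR hR0
  have hlim : Tendsto (driftS a gam n) (𝓝[>] 0) (𝓝 0) := by
    simpa only [ContinuousWithinAt, driftS_zero h] using hdrift.mono Ioi_subset_Ici_self
  exact hasDerivWithinAt_Ici_of_tendsto hβ hlim fun t ht => hasDerivAt_kernelBeta ht hgam n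

theorem linearized_driftR {ρ κ : ℝ} {n : ℕ} (hgam : 0 < gam) (h : 0 < gam - a)
    (hR : HasDerivWithinAt (kernelR a gam n) ρ (Ici 0) 0)
    (hS : HasDerivWithinAt (kernelS a gam n) κ (Ici 0) 0) :
    (1 - 2 * n - (gam - a)) * ρ = 2 * κ + gam * a / (gam - a) ^ 2 := by
  have hid := hasDerivWithinAt_id (0 : ℝ) (Ici 0)
  have hdrift : HasDerivWithinAt (driftR a gam n) _ (Ici 0) 0 :=
    ((hS.const_mul 2).sub_const gam).add
      (((hid.const_sub (2 * n + gam - a)).add (hid.mul hR)).mul hR)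
  have hlim := (uniqueDiffWithinAt_Ici (0 : ℝ)).eq_deriv _ hR
    (hasDerivWithinAt_Ici_of_hasDerivAt_div hR.continuousWithinAt hdrift (driftR_zero h n)
      fun t ht => hasDerivAt_kernelR ht hgam n)
  simp only [Pi.add_apply, Pi.mul_apply, id, kernelR_zero h] at hlim
  field_simp at hlim ⊢
  linear_combination hlim

theorem linearized_driftS {ρ κ : ℝ} {n : ℕ} (hgam : 0 < gam) (h : 0 < gam - a)
    (hR : HasDerivWithinAt (kernelR a gam n) ρ (Ici 0) 0)
    (hS : HasDerivWithinAt (kernelS a gam n) κ (Ici 0) 0) :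
    (1 + 2 * n + (gam - a)) * κ = -(2 * n * (n + (gam - a))) * ρ := by
  have hβ := hasDerivWithinAt_kernelBeta_zero hgam h n
  have hR0 : kernelR a gam n 0 ≠ 0 := by
    rw [kernelR_zero h]
    exact (div_pos hgam h).ne'
  have hdrift : HasDerivWithinAt (driftS a gam n) _ (Ici 0) 0 :=
    (((hS.pow 2).sub (hS.const_mul gam)).sub (hβ.mul (hR.pow 2))).div hR hR0
  have hlim := (uniqueDiffWithinAt_Ici (0 : ℝ)).eq_deriv _ hS
    (hasDerivWithinAt_Ici_of_hasDerivAt_div hS.continuousWithinAt hdrift (driftS_zero h n)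
      fun t ht => hasDerivAt_kernelS ht hgam n)
  simp only [Pi.sub_apply, Pi.mul_apply, Pi.pow_apply, kernelR_zero h, kernelS_zero h,
    kernelBeta_zero h] at hlim
  push_cast at hlim
  field_simp at hlim
  refine mul_left_cancel₀ h.ne' ?_
  linear_combination hlim

theorem hasDerivWithinAt_kernelR_zero (hgam : 0 < gam) (h : 1 < gam - a) (n : ℕ) :
    HasDerivWithinAt (kernelR a gam n)
      ((2 * n + 1 + gam - a) * a * gam / ((gam - a) ^ 2 * (1 - (gam - a) ^ 2))) (Ici 0) 0 := by
  have hR := (differentiableWithinAt_kernelR_zero hgam h n).hasDerivWithinAt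
  have hS := (differentiableWithinAt_kernelS_zero hgam h n).hasDerivWithinAt
  have hlinR := linearized_driftR hgam (by linarith) hR hS
  have hlinS := linearized_driftS hgam (by linarith) hR hS
  have hg : gam - a ≠ 0 := by linarith
  have hg2 : 1 - (gam - a) ^ 2 ≠ 0 := by nlinarith
  rw [← sub_eq_iff_eq_add', eq_div_iff (pow_ne_zero 2 hg)] at hlinR
  refine hR.congr_deriv ?_
  rw [eq_div_iff (mul_ne_zero (pow_ne_zero 2 hg) hg2)]
  linear_combination (1 + 2 * n + (gam - a)) * hlinR + 2 * (gam - a) ^ 2 * hlinS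

end AtZero

/-! ### The `σ`-form -/

/-- A closed form of `Ĥ_n`, defined for all parameters. -/
def kernelH (a gam : ℝ) (n : ℕ) (t : ℝ) : ℝ := n ^ 2 + n * (gam - a - t) + kernelNext a gam n t

section SigmaForm

variable {a gam t : ℝ}

theorem contDiffOn_kernelH (hgam : -1 < gam) (m n : ℕ) :
    ContDiffOn ℝ m (kernelH a gam n) (Ioi 0) := by
  intro t ht
  have hnext : ContDiffAt ℝ m (kernelNext a gam n) t :=
    (IsFieldClosed.contDiffAt m t).nextCoeff_orthoPoly (contDiffAt_polyInt_X_pow a ht hgam m)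
      (isMonicOrthogonal_kernelOP (Or.inl ⟨ht, hgam⟩)).ne_zero n
  exact ((contDiffAt_const.add (contDiffAt_const.mul (contDiffAt_const.sub contDiffAt_id))).add
    hnext).contDiffWithinAt

theorem hasDerivAt_kernelH (ht : 0 < t) (hgam : 0 < gam) (n : ℕ) :
    HasDerivAt (kernelH a gam n) (kernelS a gam n t) t :=
  ((((((hasDerivAt_id t).const_sub (gam - a)).const_mul (n : ℝ)).const_add ((n : ℝ) ^ 2)).add
    (hasDerivAt_kernelNext ht hgam n)).congr_deriv (by ring))

theorem deriv_deriv_kernelH (ht : 0 < t) (hgam : 0 < gam) (n : ℕ) :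
    deriv (deriv (kernelH a gam n)) t = driftS a gam n t / t := by
  have hderiv : EqOn (deriv (kernelH a gam n)) (kernelS a gam n) (Ioi 0) := fun s hs =>
    (hasDerivAt_kernelH hs hgam n).deriv
  rw [hderiv.deriv isOpen_Ioi ht, (hasDerivAt_kernelS ht hgam n).deriv]

theorem kernelH_eq (h : Admissible a (gam - 1) t) (n : ℕ) :
    kernelH a gam n t = n ^ 2 + n * (gam - a) + t * kernelS a gam n t - kernelBeta a gam n t := by
  rw [kernelH, kernelBeta_eq h]
  ring

theorem kernelH_sigma_form (ht : 0 < t) (hgam : 0 < gam) (n : ℕ) :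
    (t * deriv (deriv (kernelH a gam n)) t) ^ 2 =
      4 * (n + deriv (kernelH a gam n) t) *
          (kernelH a gam n t - t * deriv (kernelH a gam n) t) *
          (deriv (kernelH a gam n) t - gam) +
        ((t - gam + a) * deriv (kernelH a gam n) t - kernelH a gam n t - n * gam) ^ 2 := by
  have h : Admissible a (gam - 1) t := Or.inl ⟨ht, by linarith⟩
  have hR := (kernelR_pos h hgam n).ne'
  have hβ := kernelBeta_mul h n
  rw [deriv_deriv_kernelH ht hgam, (hasDerivAt_kernelH ht hgam n).deriv, kernelH_eq h,
    mul_div_cancel₀ _ ht.ne', driftS]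
  generalize kernelR a gam n t = R at hR hβ ⊢
  generalize kernelS a gam n t = S at hβ ⊢
  generalize kernelBeta a gam n t = β at hβ ⊢
  field_simp
  linear_combination (S ^ 2 - gam * S + β * R ^ 2 +
    R * (β + (a - gam - 2 * n) * S + n * (a - n))) * hβ

theorem sigma_form_of_eqOn_kernelH {H : ℝ → ℝ} {n : ℕ} (hH : EqOn H (kernelH a gam n) (Ioi 0))
    (ht : 0 < t) (hgam : 0 < gam) :
    (t * deriv (deriv H) t) ^ 2 =
      4 * (n + deriv H t) * (H t - t * deriv H t) * (deriv H t - gam) +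
        ((t - gam + a) * deriv H t - H t - n * gam) ^ 2 := by
  have hderiv := hH.deriv isOpen_Ioi
  rw [hderiv.deriv isOpen_Ioi ht, hderiv ht, hH ht]
  exact kernelH_sigma_form ht hgam n

theorem satisfiesSigmaPV_of_sigma_form {H : ℝ → ℝ} {ν : ℝ} (hH : ContDiffOn ℝ 2 H (Ioi 0))
    (h : ∀ t, 0 < t → (t * deriv (deriv H) t) ^ 2 =
      4 * (ν + deriv H t) * (H t - t * deriv H t) * (deriv H t - gam) +
        ((t - gam + a) * deriv H t - H t - ν * gam) ^ 2) :
    SatisfiesSigmaPV 0 (-ν) (-a) (-ν - gam) fun t => H t + ν * t + ν * a := by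
  have hderiv : EqOn (deriv fun t => H t + ν * t + ν * a) (fun t => deriv H t + ν) (Ioi 0) :=
    fun t ht => by
      have hHt := ((hH.differentiableOn (by simp)).differentiableAt
        (Ioi_mem_nhds ht)).hasDerivAt
      exact (((hHt.add ((hasDerivAt_id t).const_mul ν)).add_const (ν * a)).congr_deriv
        (by ring)).deriv
  refine ⟨(hH.add (contDiffOn_const.mul contDiffOn_id)).add contDiffOn_const, fun t ht => ?_⟩
  rw [hderiv.deriv isOpen_Ioi ht, hderiv ht, deriv_add_const]
  linear_combination h t ht

theorem kernelH_zero (h : -1 < gam - a) (n : ℕ) : kernelH a gam n 0 = 0 := by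
  rw [kernelH, kernelNext_zero h]
  ring

theorem continuousWithinAt_kernelH_zero (hgam : -1 < gam) (h : -1 < gam - a) (n : ℕ) :
    ContinuousWithinAt (kernelH a gam n) (Ici 0) 0 :=
  ContinuousWithinAt.add (by fun_prop) (continuousWithinAt_kernelNext_zero hgam h n)

theorem hasDerivWithinAt_kernelH_zero (hgam : 0 < gam) (h : 0 < gam - a) (n : ℕ) :
    HasDerivWithinAt (kernelH a gam n) (n * gam / (a - gam)) (Ici 0) 0 := by
  have hlim := (continuousWithinAt_kernelS_zero hgam h n).mono Ioi_subset_Ici_self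
  rw [ContinuousWithinAt, kernelS_zero h, ← div_neg, neg_sub] at hlim
  exact hasDerivWithinAt_Ici_of_tendsto
    (continuousWithinAt_kernelH_zero (by linarith) (by linarith) n) hlim
    fun t ht => hasDerivAt_kernelH ht hgam n

end SigmaForm

/-! ### Painlevé V -/

/-- A closed form of `ŷ`, defined for all parameters. -/
def kernelY (a gam : ℝ) (n : ℕ) (t : ℝ) : ℝ := 1 + 1 / (kernelR a gam n t - 1)

section PainleveFive

variable {a gam t : ℝ}

theorem contDiffOn_kernelY (hgam : 0 < gam) (ha : a ≠ 0) (m n : ℕ) :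
    ContDiffOn ℝ m (kernelY a gam n) (Ioi 0) := by
  intro t ht
  have h : Admissible a (gam - 1) t := Or.inl ⟨ht, by linarith⟩
  have hR : ContDiffAt ℝ m (kernelR a gam n) t :=
    (IsFieldClosed.contDiffAt m t).ladderR gam
      (contDiffAt_polyInt_X_pow a ht (by linarith) m)
      (contDiffAt_polyInt_X_pow a ht (by linarith) m)
      (isMonicOrthogonal_kernelOP h.of_sub_one).ne_zero n
  exact (contDiffAt_const.add (contDiffAt_const.div (hR.sub contDiffAt_const)
    (sub_ne_zero.2 (kernelR_ne_one h ha n)))).contDiffWithinAt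

theorem kernelY_sub_one (n : ℕ) : kernelY a gam n t - 1 = 1 / (kernelR a gam n t - 1) :=
  add_sub_cancel_left _ _

theorem one_add_one_div_kernelY_sub_one (n : ℕ) :
    1 + 1 / (kernelY a gam n t - 1) = kernelR a gam n t := by
  rw [kernelY_sub_one, one_div_one_div, add_sub_cancel]

theorem kernelY_eq_div (h : Admissible a (gam - 1) t) (ha : a ≠ 0) (n : ℕ) :
    kernelY a gam n t = kernelR a gam n t / (kernelR a gam n t - 1) := by
  rw [kernelY, one_add_div (sub_ne_zero.2 (kernelR_ne_one h ha n)), sub_add_cancel]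

theorem kernelY_ne_zero (h : Admissible a (gam - 1) t) (hgam : 0 < gam) (ha : a ≠ 0) (n : ℕ) :
    kernelY a gam n t ≠ 0 := by
  rw [kernelY_eq_div h ha]
  exact div_ne_zero (kernelR_pos h hgam n).ne' (sub_ne_zero.2 (kernelR_ne_one h ha n))

theorem kernelY_ne_one (h : Admissible a (gam - 1) t) (ha : a ≠ 0) (n : ℕ) :
    kernelY a gam n t ≠ 1 := by
  rw [← sub_ne_zero, kernelY_sub_one]
  exact one_div_ne_zero (sub_ne_zero.2 (kernelR_ne_one h ha n))

theorem hasDerivAt_kernelY (ht : 0 < t) (hgam : 0 < gam) (ha : a ≠ 0) (n : ℕ) :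
    HasDerivAt (kernelY a gam n) (-(driftR a gam n t / (t * (kernelR a gam n t - 1) ^ 2))) t := by
  have hR := sub_ne_zero.2 (kernelR_ne_one (Or.inl ⟨ht, by linarith⟩) ha n)
  have hinv := (((hasDerivAt_kernelR (a := a) ht hgam n).sub_const 1).inv hR).const_add 1
  simp only [Pi.inv_apply, ← one_div] at hinv
  exact hinv.congr_deriv (by rw [neg_div, div_div])

theorem hasDerivAt_driftR (ht : 0 < t) (hgam : 0 < gam) (n : ℕ) :
    HasDerivAt (driftR a gam n) (2 * (driftS a gam n t / t) +
      ((-1 + kernelR a gam n t + driftR a gam n t) * kernelR a gam n t +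
        (2 * n + gam - a - t + t * kernelR a gam n t) * (driftR a gam n t / t))) t := by
  have hR := hasDerivAt_kernelR (a := a) ht hgam n
  have hid := hasDerivAt_id t
  refine ((((hasDerivAt_kernelS (a := a) ht hgam n).const_mul 2).sub_const gam).add
    (((hid.const_sub (2 * n + gam - a)).add (hid.mul hR)).mul hR)).congr_deriv ?_
  simp only [Pi.add_apply, Pi.mul_apply, id]
  field_simp
  ring

theorem kernelBeta_eq_div (h : Admissible a (gam - 1) t) (hgam : 0 < gam) (ha : a ≠ 0) (n : ℕ) :
    kernelBeta a gam n t =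
      (-(kernelS a gam n t ^ 2 - gam * kernelS a gam n t) + kernelR a gam n t *
        ((a - gam - 2 * n) * kernelS a gam n t + n * (a - n))) /
          (kernelR a gam n t * (kernelR a gam n t - 1)) := by
  rw [eq_div_iff (mul_ne_zero (kernelR_pos h hgam n).ne' (sub_ne_zero.2 (kernelR_ne_one h ha n))),
    ← mul_assoc, kernelBeta_mul h]

theorem deriv_deriv_kernelY (ht : 0 < t) (hgam : 0 < gam) (ha : a ≠ 0) (n : ℕ) :
    deriv (deriv (kernelY a gam n)) t =
      -((deriv (driftR a gam n) t * (t * (kernelR a gam n t - 1) ^ 2) - driftR a gam n t *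
        ((kernelR a gam n t - 1) ^ 2 + 2 * (kernelR a gam n t - 1) * driftR a gam n t)) /
          (t * (kernelR a gam n t - 1) ^ 2) ^ 2) := by
  have hR := sub_ne_zero.2 (kernelR_ne_one (Or.inl ⟨ht, by linarith⟩) ha n)
  have hderiv : EqOn (deriv (kernelY a gam n))
      (fun s => -(driftR a gam n s / (s * (kernelR a gam n s - 1) ^ 2))) (Ioi 0) :=
    fun s hs => (hasDerivAt_kernelY hs hgam ha n).deriv
  have hden := (hasDerivAt_id t).mul (((hasDerivAt_kernelR (a := a) ht hgam n).sub_const 1).pow 2)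
  have hquot := ((hasDerivAt_driftR (a := a) ht hgam n).div hden
    (mul_ne_zero ht.ne' (pow_ne_zero 2 hR))).neg
  rw [hderiv.deriv isOpen_Ioi ht, (hasDerivAt_driftR ht hgam n).deriv]
  refine hquot.deriv.trans ?_
  simp only [Pi.mul_apply, Pi.pow_apply, id]
  push_cast
  field_simp

theorem kernelY_painleve_five (ht : 0 < t) (hgam : 0 < gam) (ha : a ≠ 0) (n : ℕ) :
    deriv (deriv (kernelY a gam n)) t =
      (3 * kernelY a gam n t - 1) * deriv (kernelY a gam n) t ^ 2 /
          (2 * kernelY a gam n t * (kernelY a gam n t - 1))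
        - deriv (kernelY a gam n) t / t
        + (kernelY a gam n t - 1) ^ 2 / (2 * t ^ 2) *
          (a ^ 2 * kernelY a gam n t - gam ^ 2 / kernelY a gam n t)
        - (2 * n + 1 + gam - a) * kernelY a gam n t / t
        - kernelY a gam n t * (kernelY a gam n t + 1) / (2 * (kernelY a gam n t - 1)) := by
  have h : Admissible a (gam - 1) t := Or.inl ⟨ht, by linarith⟩
  have hR0 := (kernelR_pos h hgam n).ne'
  have hR1 := sub_ne_zero.2 (kernelR_ne_one h ha n)
  rw [deriv_deriv_kernelY ht hgam ha, (hasDerivAt_driftR ht hgam n).deriv,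
    (hasDerivAt_kernelY ht hgam ha n).deriv, kernelY_sub_one,
    kernelY_eq_div h ha, driftS, kernelBeta_eq_div h hgam ha, driftR]
  generalize kernelS a gam n t = S
  generalize kernelR a gam n t = R at hR0 hR1 ⊢
  field_simp
  ring

theorem kernelH_eq_kernelY (ht : 0 < t) (hgam : 0 < gam) (ha : a ≠ 0) (n : ℕ) :
    kernelH a gam n t =
      (t * deriv (kernelY a gam n) t) ^ 2 / (4 * kernelY a gam n t * (kernelY a gam n t - 1) ^ 2)
        - (a * kernelY a gam n t - gam) ^ 2 / (4 * kernelY a gam n t)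
        + t * (a - 2 * n) * kernelY a gam n t / (2 * (kernelY a gam n t - 1))
        - gam * t / (2 * (kernelY a gam n t - 1))
        - t ^ 2 * kernelY a gam n t / (4 * (kernelY a gam n t - 1) ^ 2) := by
  have h : Admissible a (gam - 1) t := Or.inl ⟨ht, by linarith⟩
  have hR0 := (kernelR_pos h hgam n).ne'
  have hR1 := sub_ne_zero.2 (kernelR_ne_one h ha n)
  rw [(hasDerivAt_kernelY ht hgam ha n).deriv, kernelY_sub_one, kernelY_eq_div h ha,
    kernelH_eq h, kernelBeta_eq_div h hgam ha, driftR]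
  generalize kernelS a gam n t = S
  generalize kernelR a gam n t = R at hR0 hR1 ⊢
  field_simp
  ring

theorem kernelR_zero_sub_one (h : 0 < gam - a) (n : ℕ) :
    kernelR a gam n 0 - 1 = a / (gam - a) := by
  rw [kernelR_zero h, div_sub_one h.ne', sub_sub_cancel]

theorem kernelY_zero (h : 0 < gam - a) (ha : a ≠ 0) (n : ℕ) : kernelY a gam n 0 = gam / a := by
  rw [kernelY, kernelR_zero_sub_one h, one_div_div, one_add_div ha, add_sub_cancel]

theorem continuousWithinAt_kernelY_zero (hgam : 0 < gam) (h : 0 < gam - a) (ha : a ≠ 0) (n : ℕ) :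
    ContinuousWithinAt (kernelY a gam n) (Ici 0) 0 :=
  continuousWithinAt_const.add (continuousWithinAt_const.div
    ((continuousWithinAt_kernelR_zero hgam h n).sub continuousWithinAt_const)
    (by rw [kernelR_zero_sub_one h]; exact div_ne_zero ha h.ne'))

theorem hasDerivWithinAt_kernelY_zero (hgam : 0 < gam) (h : 1 < gam - a) (ha : a ≠ 0) (n : ℕ) :
    HasDerivWithinAt (kernelY a gam n)
      (gam * (2 * n + 1 + gam - a) / (a * ((a - gam) ^ 2 - 1))) (Ici 0) 0 := by
  have h0 : 0 < gam - a := by linarith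
  have hR : kernelR a gam n 0 - 1 ≠ 0 := by
    rw [kernelR_zero_sub_one h0]
    exact div_ne_zero ha h0.ne'
  have hinv := (((hasDerivWithinAt_kernelR_zero hgam h n).sub_const 1).inv hR).const_add 1
  simp only [Pi.inv_apply, ← one_div] at hinv
  refine hinv.congr_deriv ?_
  have hden : 1 - (gam - a) ^ 2 ≠ 0 := by nlinarith
  have hden' : (a - gam) ^ 2 - 1 ≠ 0 := by nlinarith
  rw [kernelR_zero_sub_one h0]
  field_simp
  ring

end PainleveFive

/-! ### Transfer to `Ĥ_n` and `ŷ` -/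

section Transfer

variable {lam bet gam t : ℝ}

theorem hasDerivAt_log_hankelDet_div (ht : 0 < t) (hgam : 0 < gam) {c : ℝ} (hc : c ≠ 0) (n : ℕ) :
    HasDerivAt (fun s => Real.log (hankelDet lam bet gam n s / c))
      (-∑ j ∈ Finset.range n, Rhat lam bet gam j t) t := by
  have hnorm {s : ℝ} (hs : 0 < s) (j : ℕ) : kernelNorm (lam + bet) gam j s ≠ 0 :=
    (kernelNorm_pos (Or.inl ⟨hs, by linarith⟩) j).ne'
  have hsum : HasDerivAt (fun s => ∑ j ∈ Finset.range n,
      Real.log (kernelNorm (lam + bet) gam j s) - Real.log c)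
      (∑ j ∈ Finset.range n, -(kernelR (lam + bet) gam j t * kernelNorm (lam + bet) gam j t) /
        kernelNorm (lam + bet) gam j t) t :=
    (HasDerivAt.fun_sum fun j _ => (hasDerivAt_kernelNorm ht hgam j).log (hnorm ht j)).sub_const _
  refine (hsum.congr_deriv ?_).congr_of_eventuallyEq ?_
  · rw [← Finset.sum_neg_distrib]
    refine Finset.sum_congr rfl fun j _ => ?_
    rw [neg_div, mul_div_cancel_right₀ _ (hnorm ht j),
      Rhat_eq_ladderR (Or.inl ⟨ht, by linarith⟩)]
    rfl
  · filter_upwards [Ioi_mem_nhds ht] with s hs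
    have h : Admissible (lam + bet) gam s := Or.inl ⟨hs, by linarith⟩
    rw [Real.log_div (hankelDet_pos h n).ne' hc, hankelDet_eq_prod h]
    exact congrArg (· - Real.log c) (Real.log_prod fun j _ => hnorm hs j)

theorem eqOn_mul_deriv_log_hankelDet_div (hgam : 0 < gam) {c : ℝ} (hc : c ≠ 0) (n : ℕ) :
    EqOn (fun t => t * deriv (fun s => Real.log (hankelDet lam bet gam n s / c)) t)
      (kernelH (lam + bet) gam n) (Ioi 0) := by
  intro t ht
  have h : Admissible (lam + bet) (gam - 1) t := Or.inl ⟨ht, by linarith⟩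
  beta_reduce
  rw [(hasDerivAt_log_hankelDet_div ht hgam hc n).deriv, mul_neg,
    Finset.sum_congr rfl fun j _ => Rhat_eq_ladderR h j]
  exact neg_mul_sum_kernelR h n

theorem eqOn_mul_deriv_log_hankelDet_div_Ici (hgam : 0 < gam) (h : -1 < gam - (lam + bet)) {c : ℝ}
    (hc : c ≠ 0) (n : ℕ) :
    EqOn (fun t => t * deriv (fun s => Real.log (hankelDet lam bet gam n s / c)) t)
      (kernelH (lam + bet) gam n) (Ici 0) := by
  intro t ht
  rcases (mem_Ici.1 ht).eq_or_lt with rfl | ht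
  · exact (zero_mul _).trans (kernelH_zero h n).symm
  · exact eqOn_mul_deriv_log_hankelDet_div hgam hc n ht

theorem yhat_eq_kernelY (h : Admissible (lam + bet) (gam - 1) t) (n : ℕ) :
    yhat lam bet gam n t = kernelY (lam + bet) gam n t := by
  rw [yhat, Rhat_eq_ladderR h]
  rfl

theorem eqOn_yhat_kernelY (hgam : 0 < gam) (n : ℕ) :
    EqOn (yhat lam bet gam n) (kernelY (lam + bet) gam n) (Ioi 0) := fun t ht =>
  yhat_eq_kernelY (Or.inl ⟨ht, by linarith⟩) n

theorem eqOn_yhat_kernelY_Ici (hgam : 0 < gam) (h : 0 < gam - (lam + bet)) (n : ℕ) :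
    EqOn (yhat lam bet gam n) (kernelY (lam + bet) gam n) (Ici 0) := by
  intro t ht
  rcases (mem_Ici.1 ht).eq_or_lt with rfl | ht
  · exact yhat_eq_kernelY (Or.inr ⟨rfl, by linarith⟩) n
  · exact eqOn_yhat_kernelY hgam n ht

end Transfer

end PerturbedLaguerre

end

open PerturbedLaguerre in
theorem theorem8_general (lam bet gam : ℝ) (hgam : 0 < gam) (n : ℕ) (c : ℝ) (hc : c ≠ 0)
    (D R y H : ℝ → ℝ)
    (hD : D = PerturbedLaguerre.hankelDet lam bet gam n)
    (hR : R = PerturbedLaguerre.Rhat lam bet gam n)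
    (hy : y = PerturbedLaguerre.yhat lam bet gam n)
    (hH : H = fun t => t * deriv (fun s => Real.log (D s / c)) t) :
    (bet + lam ≠ 0 →
      ContDiffOn ℝ 2 y (Ioi 0) ∧
      (∀ t : ℝ, 0 < t → y t ≠ 0 ∧ y t ≠ 1 ∧ R t = 1 + 1 / (y t - 1)) ∧
      (∀ t : ℝ, 0 < t →
        deriv (deriv y) t =
          (3 * y t - 1) * deriv y t ^ 2 / (2 * y t * (y t - 1)) - deriv y t / t
          + (y t - 1) ^ 2 / (2 * t ^ 2) * ((bet + lam) ^ 2 * y t - gam ^ 2 / y t)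
          - (2 * n + 1 + gam - bet - lam) * y t / t
          - y t * (y t + 1) / (2 * (y t - 1))) ∧
      (0 < gam - lam - bet →
        y 0 = gam / (bet + lam) ∧ ContinuousWithinAt y (Ici 0) 0) ∧
      (1 < gam - lam - bet →
        HasDerivWithinAt y
          (gam * (2 * n + 1 + gam - bet - lam) / ((bet + lam) * ((bet + lam - gam) ^ 2 - 1)))
          (Ici 0) 0) ∧
      (∀ t : ℝ, 0 < t →
        H t =
          (t * deriv y t) ^ 2 / (4 * y t * (y t - 1) ^ 2)
          - ((bet + lam) * y t - gam) ^ 2 / (4 * y t)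
          + t * (bet + lam - 2 * n) * y t / (2 * (y t - 1))
          - gam * t / (2 * (y t - 1))
          - t ^ 2 * y t / (4 * (y t - 1) ^ 2))) ∧
    (∀ t : ℝ, 0 < t → 0 < D t) ∧
    (∀ t : ℝ, 0 < t →
      HasDerivAt (fun s => Real.log (D s / c))
        (-∑ j ∈ Finset.range n, PerturbedLaguerre.Rhat lam bet gam j t) t) ∧
    ContDiffOn ℝ 2 H (Ioi 0) ∧
    (∀ t : ℝ, 0 < t →
      (t * deriv (deriv H) t) ^ 2 =
        4 * (n + deriv H t) * (H t - t * deriv H t) * (deriv H t - gam)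
        + ((t - gam + bet + lam) * deriv H t - H t - n * gam) ^ 2) ∧
    PerturbedLaguerre.SatisfiesSigmaPV 0 (-n) (-bet - lam) (-n - gam)
      (fun t => H t + n * t + n * (bet + lam)) ∧
    H 0 = 0 ∧
    (-1 < gam - lam - bet → 0 < D 0 ∧ ContinuousWithinAt H (Ici 0) 0) ∧
    (0 < gam - lam - bet →
      HasDerivWithinAt H (n * gam / (bet + lam - gam)) (Ici 0) 0) := by
  have hyY : EqOn y (kernelY (lam + bet) gam n) (Ioi 0) := hy ▸ eqOn_yhat_kernelY hgam n
  have hyY' (h : 0 < gam - lam - bet) : EqOn y (kernelY (lam + bet) gam n) (Ici 0) :=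
    hy ▸ eqOn_yhat_kernelY_Ici hgam (by linarith) n
  have hHK : EqOn H (kernelH (lam + bet) gam n) (Ioi 0) :=
    hH ▸ hD ▸ eqOn_mul_deriv_log_hankelDet_div hgam hc n
  have hHK' (h : -1 < gam - lam - bet) : EqOn H (kernelH (lam + bet) gam n) (Ici 0) :=
    hH ▸ hD ▸ eqOn_mul_deriv_log_hankelDet_div_Ici hgam (by linarith) hc n
  have hdy := hyY.deriv isOpen_Ioi
  have hH_smooth := (contDiffOn_kernelH (by linarith) 2 n).congr hHK
  have hH_sigma (t : ℝ) (ht : 0 < t) := sigma_form_of_eqOn_kernelH hHK ht hgam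
  have hH_PV := satisfiesSigmaPV_of_sigma_form hH_smooth hH_sigma
  rw [neg_add_rev, ← sub_eq_add_neg] at hH_PV
  rw [add_comm bet lam]
  refine ⟨fun ha => ⟨(contDiffOn_kernelY hgam ha 2 n).congr hyY, fun t ht => ?_, fun t ht => ?_,
    fun h => ?_, fun h => ?_, fun t ht => ?_⟩, fun t ht => ?_, fun t ht => ?_, hH_smooth,
    fun t ht => ?_, hH_PV, hH ▸ zero_mul _, fun h => ⟨?_, ?_⟩, fun h => ?_⟩
  · have h : Admissible (lam + bet) (gam - 1) t := Or.inl ⟨ht, by linarith⟩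
    rw [hyY ht, hR, Rhat_eq_ladderR h, one_add_one_div_kernelY_sub_one]
    exact ⟨kernelY_ne_zero h hgam ha n, kernelY_ne_one h ha n, rfl⟩
  · rw [hdy.deriv isOpen_Ioi ht, hdy ht, hyY ht]
    linear_combination kernelY_painleve_five ht hgam ha n
  · exact ⟨(hyY' h self_mem_Ici).trans (kernelY_zero (by linarith) ha n),
      (continuousWithinAt_kernelY_zero hgam (by linarith) ha n).congr_of_mem (hyY' h) self_mem_Ici⟩
  · rw [sub_sub _ bet, add_comm bet]
    exact (hasDerivWithinAt_kernelY_zero hgam (by linarith) ha n).congr_of_mem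
      (hyY' (by linarith)) self_mem_Ici
  · rw [hHK ht, hdy ht, hyY ht]
    exact kernelH_eq_kernelY ht hgam ha n
  · exact hD ▸ hankelDet_pos (Or.inl ⟨ht, by linarith⟩) n
  · exact hD ▸ hasDerivAt_log_hankelDet_div ht hgam hc n
  · linear_combination hH_sigma t ht
  · exact hD ▸ hankelDet_pos (Or.inr ⟨rfl, by linarith⟩) n
  · exact (continuousWithinAt_kernelH_zero (by linarith) (by linarith) n).congr_of_mem
      (hHK' h) self_mem_Ici
  · exact (hasDerivWithinAt_kernelH_zero hgam (by linarith) n).congr_of_mem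
      (hHK' (by linarith)) self_mem_Ici

theorem theorem8 (lam bet gam : ℝ) (hlam : lam < 0) (hbet : 0 < bet) (hgam : 0 < gam)
    (hpar : -1 < gam - lam - bet) (n : ℕ) (D R y H : ℝ → ℝ)
    (hD : D = PerturbedLaguerre.hankelDet lam bet gam n)
    (hR : R = PerturbedLaguerre.Rhat lam bet gam n)
    (hy : y = PerturbedLaguerre.yhat lam bet gam n)
    (hH : H = PerturbedLaguerre.Hhat lam bet gam n) :
    -- the function `ŷ`, which is defined when `β + λ ≠ 0`
    (bet + lam ≠ 0 →
      ContDiffOn ℝ 2 y (Ioi 0) ∧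
      (∀ t : ℝ, 0 < t → y t ≠ 0 ∧ y t ≠ 1 ∧ R t = 1 + 1 / (y t - 1)) ∧
      -- Painlevé V
      (∀ t : ℝ, 0 < t →
        deriv (deriv y) t =
          (3 * y t - 1) * deriv y t ^ 2 / (2 * y t * (y t - 1)) - deriv y t / t
          + (y t - 1) ^ 2 / (2 * t ^ 2) * ((bet + lam) ^ 2 * y t - gam ^ 2 / y t)
          - (2 * n + 1 + gam - bet - lam) * y t / t
          - y t * (y t + 1) / (2 * (y t - 1))) ∧
      -- initial data
      (0 < gam - lam - bet →
        y 0 = gam / (bet + lam) ∧ ContinuousWithinAt y (Ici 0) 0) ∧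
      (1 < gam - lam - bet →
        HasDerivWithinAt y
          (gam * (2 * n + 1 + gam - bet - lam) / ((bet + lam) * ((bet + lam - gam) ^ 2 - 1)))
          (Ici 0) 0) ∧
      -- `Ĥ_n` in terms of `ŷ` and `ŷ'`
      (∀ t : ℝ, 0 < t →
        H t =
          (t * deriv y t) ^ 2 / (4 * y t * (y t - 1) ^ 2)
          - ((bet + lam) * y t - gam) ^ 2 / (4 * y t)
          + t * (bet + lam - 2 * n) * y t / (2 * (y t - 1))
          - gam * t / (2 * (y t - 1))
          - t ^ 2 * y t / (4 * (y t - 1) ^ 2))) ∧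
    -- the function `Ĥ_n`
    (∀ t : ℝ, 0 ≤ t → 0 < D t) ∧
    (∀ t : ℝ, 0 < t →
      HasDerivAt (fun s => Real.log (D s / D 0))
        (-∑ j ∈ Finset.range n, PerturbedLaguerre.Rhat lam bet gam j t) t) ∧
    ContDiffOn ℝ 2 H (Ioi 0) ∧
    (∀ t : ℝ, 0 < t →
      (t * deriv (deriv H) t) ^ 2 =
        4 * (n + deriv H t) * (H t - t * deriv H t) * (deriv H t - gam)
        + ((t - gam + bet + lam) * deriv H t - H t - n * gam) ^ 2) ∧
    PerturbedLaguerre.SatisfiesSigmaPV 0 (-n) (-bet - lam) (-n - gam)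
      (fun t => H t + n * t + n * (bet + lam)) ∧
    H 0 = 0 ∧ ContinuousWithinAt H (Ici 0) 0 ∧
    (0 < gam - lam - bet →
      HasDerivWithinAt H (n * gam / (bet + lam - gam)) (Ici 0) 0) := by
  have hadm : PerturbedLaguerre.Admissible (lam + bet) gam 0 := Or.inr ⟨rfl, by linarith⟩
  have hD0 : D 0 ≠ 0 := hD ▸ (PerturbedLaguerre.hankelDet_pos hadm n).ne'
  obtain ⟨hY, hpos, hlog, hsmooth, hsigma, hPV, hzero, hcont, hderiv⟩ :=
    theorem8_general lam bet gam hgam n (D 0) hD0 D R y H hD hR hy (hD ▸ hH)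
  exact ⟨hY, fun t ht => ht.eq_or_lt.elim (· ▸ (hcont hpar).1) (hpos t), hlog, hsmooth, hsigma,
    hPV, hzero, (hcont hpar).2, hderiv⟩
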